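/- **Setting.** Let $Q=[0,1)^3$, $Q'=[-\pi,\pi)^3$, and $e_\kappa(x)=e^{i\kappa\cdot x}$. Let $C^\infty_\#(Q)$ be the smooth $Q$-periodic functions on $\mathbb R^3$ (scalar or $\mathbb C^3$-valued). Let $\mu$ be a $Q$-periodic Borel measure on $\mathbb R^3$ with $\mu(Q)=1$ and $$\int_Q\partial_j\phi\,d\mu=0\qquad\text{for all scalar }\phi\in C^\infty_\#(Q),\ j=1,2,3.$$ Let $C^\infty_{\#,0}(Q)$ be the scalar functions $\phi\in C^\infty_\#(Q)$ with $\int_Q\phi\,d\mu=0$. Let $A$ be a differentiable $Q$-periodic function on $\mathbb R^3$ whose values are real symmetric positive definite $3\times3$ matrices, and let $A^{1/2}$ be its pointwise positive square root. For $\kappa\in Q'$: - $H^1_{\mathrm{curl}A^{1/2},\kappa}$ is the closure in $L^2(Q,d\mu)\oplus L^2(Q,d\mu)$ of the pairs $(e_\kappa\phi,\ \mathrm{curl}(e_\kappa A^{1/2}\phi))$ with $A^{1/2}\phi\in C^\infty_\#(Q)$ (if $A$ is smooth, this is the same as requiring both $\phi$ and $A^{1/2}\phi$ to be in $C^\infty_\#(Q)$);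 - $\psi\in H^1_{\#,0}$ with gradient $\nabla(e_\kappa\psi)$ means that $(e_\kappa\psi,\nabla(e_\kappa\psi))$ lies in the $L^2(Q,d\mu)\oplus L^2(Q,d\mu)$-closure of the pairs $(e_\kappa\phi,\nabla(e_\kappa\phi))$, $\phi\in C^\infty_{\#,0}(Q)$; - $\Psi_\kappa=(\Psi_1,\Psi_2,\Psi_3)$ with $\Psi_j\in H^1_{\#,0}$ is a solution of $\overline{e_\kappa}\,\mathrm{div}\,A^{-1}(\nabla(e_\kappa\Psi_\kappa)+e_\kappa I)=0$, i.e. for the standard basis vectors $\mathbf e_j$, $$\int_Q A^{-1}\nabla(e_\kappa\Psi_j)\cdot\overline{\nabla(e_\kappa\phi)}\,d\mu=-\int_Q A^{-1}e_\kappa \mathbf e_j\cdot\overline{\nabla(e_\kappa\phi)}\,d\mu\quad\forall\phi\in C^\infty_{\#,0}(Q),\ j=1,2,3,$$ and $(\overline{e_\kappa}\nabla(e_\kappa\Psi_\kappa))_{ij}=\overline{e_\kappa}\,\partial_i(e_\kappa\Psi_j)$. Put $\widehat A^{\rm hom}_\kappa=\int_QA^{-1}\bigl(\overline{e_\kappa}\nabla(e_\kappa\Psi_\kappa)+I\bigr)d\mu$.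 For $\varepsilon>0$, $\theta\in\varepsilon^{-1}Q'$, $\kappa=\varepsilon\theta$, and $G\in L^2(Q,d\mu)$ with $\int_Qe_\kappa G\cdot\overline{\nabla(e_\kappa\phi)}\,d\mu=0$ for all scalar $\phi\in C^\infty_\#(Q)$, let $D^\varepsilon_\theta$ be the solution of $$\varepsilon^{-2}A^{1/2}\,\overline{e_\kappa}\,\mathrm{curl}\,\mathrm{curl}\,e_\kappa A^{1/2}D^\varepsilon_\theta+D^\varepsilon_\theta=-A^{1/2}G,$$ i.e. $(e_\kappa D^\varepsilon_\theta,\mathrm{curl}(e_\kappa A^{1/2}D^\varepsilon_\theta))\in H^1_{\mathrm{curl}A^{1/2},\kappa}$ and $$\varepsilon^{-2}\int_Q\mathrm{curl}(e_\kappa A^{1/2}D^\varepsilon_\theta)\cdot\overline{\mathrm{curl}(e_\kappa A^{1/2}\phi)}\,d\mu+\int_QD^\varepsilon_\theta\cdot\overline\phi\,d\mu=-\int_QA^{1/2}G\cdot\overline\phi\,d\mu$$ for all $(e_\kappa\phi,\mathrm{curl}(e_\kappa A^{1/2}\phi))\in H^1_{\mathrm{curl}A^{1/2},\kappa}$. **Theorem.**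 There is a constant $C>0$, independent of $\varepsilon$, $\theta$ and $G$, such that for all such $\varepsilon,\theta,G$ the matrices $\widehat A^{\rm hom}_{\varepsilon\theta}$ and $i\theta\times i\theta\times(\widehat A^{\rm hom}_{\varepsilon\theta})^{-1}+I$ are invertible, and, with $$d^\varepsilon_\theta=-\bigl(\widehat A^{\rm hom}_{\varepsilon\theta}\bigr)^{-1}\Bigl(i\theta\times i\theta\times\bigl(\widehat A^{\rm hom}_{\varepsilon\theta}\bigr)^{-1}+I\Bigr)^{-1}\int_QG\,d\mu,$$ the transformed electric field $E^\varepsilon_\theta:=A^{1/2}D^\varepsilon_\theta$ satisfies $$\Bigl\|E^\varepsilon_\theta-\bigl(\overline{e_{\varepsilon\theta}}\nabla(e_{\varepsilon\theta}\Psi_{\varepsilon\theta})+I\bigr)d^\varepsilon_\theta\Bigr\|_{L^2(Q,d\mu)}\le C\varepsilon\|G\|_{L^2(Q,d\mu)}.$$ -/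

import Mathlib

noncomputable section

namespace Maxwell

open MeasureTheory
open scoped ContDiff MatrixOrder Matrix.Norms.L2Operator

/-- The physical space `ℝ³`. -/
abbrev R3 : Type := EuclideanSpace ℝ (Fin 3)

/-- The space `ℂ³` with its Euclidean norm. -/
abbrev C3 : Type := EuclideanSpace ℂ (Fin 3)

/-- The `j`-th standard basis vector of `ℝ³`. -/
def stdVec (j : Fin 3) : R3 := EuclideanSpace.single j (1 : ℝ)

/-- The periodicity cell `Q = [0,1)³`. -/
def cellQ : Set R3 := {x | ∀ i, x i ∈ Set.Ico (0 : ℝ) 1}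

/-- The dual cell `Q' = [-π,π)³`. -/
def dualQ : Set R3 := {κ | ∀ i, κ i ∈ Set.Ico (-Real.pi) Real.pi}

/-- The space `L²(Q, dμ)` of functions with values in `V`. -/
abbrev L2Q (V : Type) [NormedAddCommGroup V] (μ : Measure R3) : Type :=
  Lp V 2 (μ.restrict cellQ)

/-- `f` has period one in every coordinate direction. -/
def IsQPeriodic {V : Type} (f : R3 → V) : Prop :=
  ∀ (i : Fin 3) (x : R3), f (x + stdVec i) = f x

/-- The class `C^∞_#(Q)` of smooth `Q`-periodic functions. -/
def SmoothPer {V : Type} [NormedAddCommGroup V] [NormedSpace ℝ V] (f : R3 → V) : Prop :=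
  ContDiff ℝ ∞ f ∧ IsQPeriodic f

/-- The class `C^∞_{#,0}(Q)` of smooth `Q`-periodic scalar functions with zero `μ`-mean over `Q`. -/
def SmoothPerZero (μ : Measure R3) (f : R3 → ℂ) : Prop :=
  SmoothPer f ∧ ∫ x in cellQ, f x ∂μ = 0

/-- The partial derivative `∂_j f`. -/
def pderiv (j : Fin 3) (f : R3 → ℂ) (x : R3) : ℂ := fderiv ℝ f x (stdVec j)

/-- The gradient of a scalar function. -/
def grad (f : R3 → ℂ) (x : R3) : C3 := WithLp.toLp 2 (fun i => pderiv i f x)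

/-- The curl of a vector function. -/
def curl (F : R3 → C3) (x : R3) : C3 :=
  !₂[pderiv 1 (fun y => F y 2) x - pderiv 2 (fun y => F y 1) x,
     pderiv 2 (fun y => F y 0) x - pderiv 0 (fun y => F y 2) x,
     pderiv 0 (fun y => F y 1) x - pderiv 1 (fun y => F y 0) x]

/-- The exponential `e_κ(x) = exp(i κ·x)`. -/
def ek (κ x : R3) : ℂ := Complex.exp (Complex.I * ((∑ i, κ i * x i : ℝ) : ℂ))

/-- A real matrix acting on a complex vector. -/
def act (M : Matrix (Fin 3) (Fin 3) ℝ) (v : C3) : C3 :=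
  WithLp.toLp 2 ((M.map Complex.ofReal).mulVec v.ofLp)

/-- The positive square root `A^{1/2}`, taken pointwise. -/
def sqrtField (A : R3 → Matrix (Fin 3) (Fin 3) ℝ) (x : R3) : Matrix (Fin 3) (Fin 3) ℝ :=
  CFC.sqrt (A x)

/-- The Sobolev space of pairs `(e_κ u, ∇(e_κ u))` with `u ∈ H¹_{#,0}(Q, dμ)`: the closure in
`L² ⊕ L²` of the pairs `(e_κ φ, ∇(e_κ φ))`, `φ ∈ C^∞_{#,0}(Q)`. -/
def H1zero (μ : Measure R3) (κ : R3) : Set (L2Q ℂ μ × L2Q C3 μ) :=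
  closure {p | ∃ φ : R3 → ℂ, SmoothPerZero μ φ ∧
    p.1 =ᵐ[μ.restrict cellQ] (fun x => ek κ x * φ x) ∧
    p.2 =ᵐ[μ.restrict cellQ] grad (fun x => ek κ x * φ x)}

/-- The Sobolev space `H¹_{curl A^{1/2}, κ}(Q, dμ)`: the closure in `L² ⊕ L²` of the pairs
`(e_κ φ, curl(e_κ A^{1/2} φ))` with `A^{1/2} φ ∈ C^∞_#(Q)`. -/
def Hcurl (μ : Measure R3) (A : R3 → Matrix (Fin 3) (Fin 3) ℝ) (κ : R3) :
    Set (L2Q C3 μ × L2Q C3 μ) :=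
  closure {p | ∃ φ : R3 → C3, SmoothPer (fun x => act (sqrtField A x) (φ x)) ∧
    p.1 =ᵐ[μ.restrict cellQ] (fun x => ek κ x • φ x) ∧
    p.2 =ᵐ[μ.restrict cellQ] curl (fun x => ek κ x • act (sqrtField A x) (φ x))}

/-- `G ∈ L²(Q, dμ)` satisfies `ē_κ div(e_κ G) = 0`. Here and below `u · v̄` is written as
`inner ℂ v u`, since Mathlib's inner product is conjugate-linear in its first argument. -/
def IsDivFree (μ : Measure R3) (κ : R3) (G : R3 → C3) : Prop :=
  MemLp G 2 (μ.restrict cellQ) ∧ ∀ φ : R3 → ℂ, SmoothPer φ →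
    ∫ x in cellQ, inner ℂ (grad (fun y => ek κ y * φ y) x) (ek κ x • G x) ∂μ = 0

/-- `D` solves `ε⁻² A^{1/2} ē_κ curl curl e_κ A^{1/2} D + D = -A^{1/2} G`: for some curl
`p.2 = curl(e_κ A^{1/2} D)` with `p = (e_κ D, p.2)` in `Hcurl`, the integral identity holds for all
test pairs `q = (e_κ φ, curl(e_κ A^{1/2} φ))` in `Hcurl`. -/
def IsMaxwellSolution (μ : Measure R3) (A : R3 → Matrix (Fin 3) (Fin 3) ℝ) (ε : ℝ) (κ : R3)
    (G D : R3 → C3) : Prop :=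
  ∃ p ∈ Hcurl μ A κ, p.1 =ᵐ[μ.restrict cellQ] (fun x => ek κ x • D x) ∧
    ∀ q ∈ Hcurl μ A κ, ∀ φ : R3 → C3, q.1 =ᵐ[μ.restrict cellQ] (fun x => ek κ x • φ x) →
      ((ε ^ 2)⁻¹ : ℂ) * ∫ x in cellQ, inner ℂ (q.2 x) (p.2 x) ∂μ
          + ∫ x in cellQ, inner ℂ (φ x) (D x) ∂μ
        = - ∫ x in cellQ, inner ℂ (φ x) (act (sqrtField A x) (G x)) ∂μ

/-- `Ψ = (Ψ₀, Ψ₁, Ψ₂)`, with gradients `g j = ∇(e_κ Ψ_j)`, solves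
`ē_κ div A⁻¹(∇(e_κ Ψ) + e_κ I) = 0` in the zero-mean space: for every `j`, `Ψ_j ∈ H¹_{#,0}` and
`∫ A⁻¹ ∇(e_κ Ψ_j) · conj ∇(e_κ φ) = -∫ A⁻¹ e_κ c · conj ∇(e_κ φ)` for all `φ ∈ C^∞_{#,0}(Q)`,
where `c` is the `j`-th basis vector. -/
def IsCellSolution (μ : Measure R3) (A : R3 → Matrix (Fin 3) (Fin 3) ℝ) (κ : R3)
    (Ψ : Fin 3 → R3 → ℂ) (g : Fin 3 → R3 → C3) : Prop :=
  ∀ j : Fin 3,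
    (∃ p ∈ H1zero μ κ, p.1 =ᵐ[μ.restrict cellQ] (fun x => ek κ x * Ψ j x) ∧
      p.2 =ᵐ[μ.restrict cellQ] g j) ∧
    ∀ φ : R3 → ℂ, SmoothPerZero μ φ →
      ∫ x in cellQ, inner ℂ (grad (fun y => ek κ y * φ y) x) (act (A x)⁻¹ (g j x)) ∂μ
        = - ∫ x in cellQ, inner ℂ (grad (fun y => ek κ y * φ y) x)
            (act (A x)⁻¹ (ek κ x • EuclideanSpace.single j (1 : ℂ))) ∂μ

/-- The matrix field `ē_κ ∇(e_κ Ψ) + I`, with `(∇Ψ)_{ij} = ∂_i Ψ_j` and `g j = ∇(e_κ Ψ_j)`. -/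
def correctorMatrix (κ : R3) (g : Fin 3 → R3 → C3) (x : R3) : Matrix (Fin 3) (Fin 3) ℂ :=
  Matrix.of (fun i j => (starRingEnd ℂ) (ek κ x) * g j x i) + 1

/-- The matrix `Â^hom_κ = ∫_Q A⁻¹ (ē_κ ∇(e_κ Ψ) + I) dμ`. -/
def hatAhom (μ : Measure R3) (A : R3 → Matrix (Fin 3) (Fin 3) ℝ) (κ : R3)
    (g : Fin 3 → R3 → C3) : Matrix (Fin 3) (Fin 3) ℂ :=
  Matrix.of (fun i j =>
    ∫ x in cellQ, (((A x)⁻¹).map Complex.ofReal * correctorMatrix κ g x) i j ∂μ)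

/-- The matrix of the map `v ↦ iθ × v` on `ℂ³`. -/
def crossI (θ : R3) : Matrix (Fin 3) (Fin 3) ℂ :=
  LinearMap.toMatrix' (crossProduct (fun i => Complex.I * (θ i : ℂ)))

/-- The matrix `iθ × iθ × (Â^hom)⁻¹ + I`. -/
def symbolMatrix (θ : R3) (Ahom : Matrix (Fin 3) (Fin 3) ℂ) : Matrix (Fin 3) (Fin 3) ℂ :=
  crossI θ * crossI θ * Ahom⁻¹ + 1

/-- The vector `d = -(Â^hom)⁻¹ (iθ × iθ × (Â^hom)⁻¹ + I)⁻¹ ∫_Q G dμ`. -/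
def dVec (μ : Measure R3) (θ : R3) (Ahom : Matrix (Fin 3) (Fin 3) ℂ) (G : R3 → C3) :
    Fin 3 → ℂ :=
  -((Ahom⁻¹ * (symbolMatrix θ Ahom)⁻¹).mulVec (∫ x in cellQ, G x ∂μ).ofLp)

end Maxwell

end

noncomputable section

namespace Maxwell

open MeasureTheory
open scoped ContDiff MatrixOrder Matrix.Norms.L2Operator

/-! Write κ = εθ. The mean-zero hypothesis on derivatives says that the exponentials e_{κ+2πk} are
orthonormal in L²(Q, dμ), and they are complete by density of trigonometric polynomials. So vector
fields have a twisted Fourier series with Parseval's identity (`hasSum_inner_coef`), in which curl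
acts as i(κ+2πk)×.

The approximation is U d = (∇(e_κ Ψ) + e_κ I) d. Its curl is the single plane wave e_κ (iκ × d),
since the gradient part is curl free, and d solves (iθ×)² d + Â d = -∫ G (`symbol_solution`).
Coercivity of Â, uniform in κ, comes from Â v · v̄ = ‖A^{-1/2} U v‖² and ‖v‖ ≤ ‖U v‖, and it bounds
U d by G.

Let w be e_κ D - A^{-1/2} U d, and let F be minus the part of e_κ G + A⁻¹ U d at frequencies other
than κ. Subtracting the equations gives the energy identity ε⁻² ‖curl A^{1/2} w‖² + ‖w‖² = ⟨A^{1/2}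
w, F⟩. The field F has no component at κ, and its other coefficients are transversal: those of G by
assumption, those of A⁻¹ U d by the cell problem. For k ≠ 0 one has |κ+2πk| ≥ π, so pairing with a
transversal coefficient costs only the curl (`norm_inner_le_of_divFree`). Young's inequality cancels
the curl term exactly and leaves ‖w‖ ≤ (ε/2π) ‖F‖. -/

/-! ### Real matrix fields and their square roots -/

lemma act_mul (M N : Matrix (Fin 3) (Fin 3) ℝ) (v : C3) : act (M * N) v = act M (act N v) := by
  have h : (M * N).map Complex.ofReal = M.map Complex.ofReal * N.map Complex.ofReal :=
    Matrix.map_mul (f := Complex.ofRealHom)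
  simp [act, h, Matrix.mulVec_mulVec]

lemma act_one (v : C3) : act 1 v = v := by
  simp [act]

lemma act_add (M : Matrix (Fin 3) (Fin 3) ℝ) (u v : C3) : act M (u + v) = act M u + act M v := by
  simp [act, Matrix.mulVec_add]

lemma act_smul (M : Matrix (Fin 3) (Fin 3) ℝ) (c : ℂ) (v : C3) : act M (c • v) = c • act M v := by
  simp [act, Matrix.mulVec_smul]

lemma inner_act {M : Matrix (Fin 3) (Fin 3) ℝ} (hM : M.IsHermitian) (u v : C3) :
    inner ℂ (act M u) v = inner ℂ u (act M v) := by
  have h : ∀ i j, M i j = M j i := fun i j => by simpa using (hM.apply i j).symm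
  simp [act, PiLp.inner_apply, Matrix.mulVec, dotProduct, Fin.sum_univ_three]
  rw [h 1 0, h 2 0, h 2 1]
  ring

lemma norm_act_le (M : Matrix (Fin 3) (Fin 3) ℝ) (v : C3) :
    ‖act M v‖ ≤ ‖M.map Complex.ofReal‖ * ‖v‖ :=
  Matrix.l2_opNorm_mulVec (M.map Complex.ofReal) v

lemma cellQ_subset_compact : ∃ K : Set R3, IsCompact K ∧ cellQ ⊆ K := by
  refine ⟨Metric.closedBall 0 3, isCompact_closedBall _ _, fun x hx => ?_⟩
  rw [mem_closedBall_zero_iff, EuclideanSpace.norm_eq, Real.sqrt_le_left (by norm_num)]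
  have : ∀ i, ‖x i‖ ^ 2 ≤ 1 := fun i => by
    have := hx i
    rw [Real.norm_eq_abs, sq_abs]
    nlinarith [this.1, this.2]
  rw [Fin.sum_univ_three]
  linarith [this 0, this 1, this 2]

/-- The cell lies in a compact set, on which a continuous matrix field is bounded; this makes
multiplication by A^{1/2} and A^{-1/2} bounded on L². -/
lemma exists_norm_act_le {M : R3 → Matrix (Fin 3) (Fin 3) ℝ} (hM : Continuous M) :
    ∃ C : ℝ, 0 < C ∧ ∀ x ∈ cellQ, ∀ v, ‖act (M x) v‖ ≤ C * ‖v‖ := by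
  obtain ⟨K, hK, hQ⟩ := cellQ_subset_compact
  obtain ⟨C, hC⟩ := hK.exists_bound_of_continuousOn
    (hM.matrix_map Complex.continuous_ofReal).continuousOn
  refine ⟨max C 1, by positivity, fun x hx v => (norm_act_le _ _).trans ?_⟩
  gcongr
  exact (hC x (hQ hx)).trans (le_max_left _ _)

lemma continuous_sqrtField {A : R3 → Matrix (Fin 3) (Fin 3) ℝ} (hA : Continuous A)
    (hpos : ∀ x, (A x).PosDef) : Continuous (sqrtField A) := by
  unfold sqrtField CFC.sqrt
  refine Continuous.cfcₙ_nnreal_of_mem_nhdsSet (s := Set.univ) _ Filter.univ_mem hA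
    (fun x => (hpos x).posSemidef.nonneg) NNReal.continuous_sqrt.continuousOn NNReal.sqrt_zero

lemma sqrtField_mul_self {A : R3 → Matrix (Fin 3) (Fin 3) ℝ} (hpos : ∀ x, (A x).PosDef) (x : R3) :
    sqrtField A x * sqrtField A x = A x :=
  CFC.sqrt_mul_sqrt_self _ (hpos x).posSemidef.nonneg

lemma sqrtField_isHermitian (A : R3 → Matrix (Fin 3) (Fin 3) ℝ) (x : R3) :
    (sqrtField A x).IsHermitian :=
  (Matrix.nonneg_iff_posSemidef.1 (CFC.sqrt_nonneg (A x))).isHermitian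

lemma isUnit_det_sqrtField {A : R3 → Matrix (Fin 3) (Fin 3) ℝ} (hpos : ∀ x, (A x).PosDef) (x : R3) :
    IsUnit (sqrtField A x).det := by
  have h := congrArg Matrix.det (sqrtField_mul_self hpos x)
  rw [Matrix.det_mul] at h
  exact isUnit_of_mul_isUnit_left (h ▸ (hpos x).det_pos.ne'.isUnit)

lemma inv_sqrtField_mul_self {A : R3 → Matrix (Fin 3) (Fin 3) ℝ} (hpos : ∀ x, (A x).PosDef)
    (x : R3) : (sqrtField A x)⁻¹ * (sqrtField A x)⁻¹ = (A x)⁻¹ := by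
  rw [← Matrix.mul_inv_rev, sqrtField_mul_self hpos]

lemma continuous_inv_sqrtField {A : R3 → Matrix (Fin 3) (Fin 3) ℝ} (hA : Continuous A)
    (hpos : ∀ x, (A x).PosDef) : Continuous fun x => (sqrtField A x)⁻¹ := by
  have hS := continuous_sqrtField hA hpos
  simp_rw [Matrix.inv_def, Ring.inverse_eq_inv']
  refine (hS.matrix_det.inv₀ fun x => (isUnit_det_sqrtField hpos x).ne_zero).smul hS.matrix_adjugate

lemma measurableSet_cellQ : MeasurableSet cellQ := by
  have : cellQ = ⋂ i : Fin 3, (fun x : R3 => x i) ⁻¹' Set.Ico (0 : ℝ) 1 := by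
    ext x; simp [cellQ]
  rw [this]
  exact MeasurableSet.iInter fun i =>
    (PiLp.continuous_apply 2 _ i).measurable measurableSet_Ico

/-- The derivatives of smooth periodic functions have zero `μ`-mean over the cell. -/
def IsDerivMeanFree (μ : Measure R3) : Prop :=
  ∀ φ : R3 → ℂ, SmoothPer φ → ∀ j : Fin 3, ∫ x in cellQ, pderiv j φ x ∂μ = 0

/-! ### Exponentials -/

lemma ek_add (ξ η x : R3) : ek (ξ + η) x = ek ξ x * ek η x := by
  simp only [ek, ← Complex.exp_add, Fin.sum_univ_three, PiLp.add_apply]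
  congr 1
  push_cast
  ring

lemma ek_zero (x : R3) : ek 0 x = 1 := by simp [ek]

lemma conj_ek (ξ x : R3) : (starRingEnd ℂ) (ek ξ x) = ek (-ξ) x := by
  simp only [ek, ← Complex.exp_conj, Fin.sum_univ_three, PiLp.neg_apply]
  congr 1
  simp only [map_mul, Complex.conj_I, Complex.conj_ofReal]
  push_cast
  ring

lemma norm_ek (ξ x : R3) : ‖ek ξ x‖ = 1 := by
  rw [ek, mul_comm, Complex.norm_exp_ofReal_mul_I]

lemma conj_ek_mul_self (ξ x : R3) : (starRingEnd ℂ) (ek ξ x) * ek ξ x = 1 := by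
  rw [conj_ek, ← ek_add, neg_add_cancel, ek_zero]

lemma ek_mul_conj_self (ξ x : R3) : ek ξ x * (starRingEnd ℂ) (ek ξ x) = 1 := by
  rw [mul_comm, conj_ek_mul_self]

lemma contDiff_ek (ξ : R3) : ContDiff ℝ ∞ (ek ξ) := by
  unfold ek
  have h : ContDiff ℝ ∞ fun x : R3 => ∑ i, ξ i * x i := by fun_prop
  exact Complex.contDiff_exp.comp (contDiff_const.mul (Complex.ofRealCLM.contDiff.comp h))

lemma continuous_ek (ξ : R3) : Continuous (ek ξ) := (contDiff_ek ξ).continuous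

lemma pderiv_mul (j : Fin 3) {f h : R3 → ℂ} {x : R3} (hf : DifferentiableAt ℝ f x)
    (hh : DifferentiableAt ℝ h x) :
    pderiv j (fun y => f y * h y) x = f x * pderiv j h x + pderiv j f x * h x := by
  simp only [pderiv]
  rw [show (fun y => f y * h y) = f * h from rfl, fderiv_mul hf hh]
  simp [mul_comm]

lemma pderiv_ek (j : Fin 3) (ξ x : R3) : pderiv j (ek ξ) x = Complex.I * ξ j * ek ξ x := by
  have h : HasFDerivAt (fun y : R3 => ∑ i, ξ i * y i)
      (∑ i, ξ i • (EuclideanSpace.proj (𝕜 := ℝ) i : R3 →L[ℝ] ℝ)) x :=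
    HasFDerivAt.fun_sum fun i _ => (EuclideanSpace.proj (𝕜 := ℝ) i).hasFDerivAt.const_mul (ξ i)
  have h2 := ((Complex.ofRealCLM.hasFDerivAt.comp x h).const_mul Complex.I).cexp
  have h3 : HasFDerivAt (ek ξ) _ x := h2
  rw [pderiv, h3.fderiv]
  simp [ek, stdVec, Fin.sum_univ_three]
  fin_cases j <;> simp <;> ring

/-- The frequency `κ + 2πk`. -/
def shift (κ : R3) (k : Fin 3 → ℤ) : R3 := κ + WithLp.toLp 2 (fun i => 2 * Real.pi * k i)

lemma shift_apply (κ : R3) (k : Fin 3 → ℤ) (i : Fin 3) :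
    shift κ k i = κ i + 2 * Real.pi * k i := rfl

lemma shift_zero_right (κ : R3) : shift κ 0 = κ := by
  ext i; simp [shift_apply]

lemma shift_eq_add (κ : R3) (k : Fin 3 → ℤ) : shift κ k = κ + shift 0 k := by
  ext i; simp [shift_apply]

lemma neg_shift_zero (k : Fin 3 → ℤ) : -shift 0 k = shift 0 (-k) := by
  ext i; simp [shift_apply]

lemma ek_shift_zero_add_stdVec (k : Fin 3 → ℤ) (i : Fin 3) (x : R3) :
    ek (shift 0 k) (x + stdVec i) = ek (shift 0 k) x := by
  have : Complex.exp (2 * Real.pi * Complex.I * k i) = 1 := by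
    rw [mul_comm]; exact Complex.exp_int_mul_two_pi_mul_I _
  have h : ek (shift 0 k) (stdVec i) = 1 := by
    rw [← this]
    simp only [ek, stdVec, shift_apply]
    congr 1
    simp
    ring
  rw [← mul_one (ek _ x), ← h]
  simp only [ek, ← Complex.exp_add, Fin.sum_univ_three, PiLp.add_apply]
  congr 1
  push_cast
  ring

lemma smoothPer_ek_shift_zero (k : Fin 3 → ℤ) : SmoothPer (ek (shift 0 k)) :=
  ⟨contDiff_ek _, fun i x => ek_shift_zero_add_stdVec k i x⟩

lemma SmoothPer.mul {f h : R3 → ℂ} (hf : SmoothPer f) (hh : SmoothPer h) :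
    SmoothPer fun x => f x * h x :=
  ⟨hf.1.mul hh.1, fun i x => by simp only [hf.2 i x, hh.2 i x]⟩

/-- Apply the hypothesis to the exponential itself: its j-th derivative is 2πi k_j times it, and
some k_j is nonzero. Thus μ has the Fourier coefficients of Lebesgue measure on the cell. -/
lemma integral_ek_shift_zero {μ : Measure R3} [IsProbabilityMeasure (μ.restrict cellQ)]
    (hmean : IsDerivMeanFree μ)
    (k : Fin 3 → ℤ) : ∫ x in cellQ, ek (shift 0 k) x ∂μ = if k = 0 then 1 else 0 := by
  split_ifs with hk
  · simp [hk, shift_zero_right, ek_zero]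
  · obtain ⟨j, hj⟩ := Function.ne_iff.1 hk
    have h := hmean _ (smoothPer_ek_shift_zero k) j
    simp_rw [pderiv_ek] at h
    rw [integral_const_mul] at h
    refine (mul_eq_zero.1 h).resolve_left ?_
    simpa [shift_apply, Real.pi_ne_zero] using hj

lemma integrable_of_continuous {μ : Measure R3} [IsFiniteMeasure (μ.restrict cellQ)] {f : R3 → ℂ}
    (hf : Continuous f) : Integrable f (μ.restrict cellQ) := by
  obtain ⟨K, hK, hQ⟩ := cellQ_subset_compact
  obtain ⟨C, hC⟩ := hK.exists_bound_of_continuousOn hf.continuousOn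
  exact Integrable.of_bound hf.aestronglyMeasurable C
    ((ae_restrict_mem measurableSet_cellQ).mono fun x hx => hC x (hQ hx))

lemma continuous_conj_ek (ξ : R3) : Continuous fun x => (starRingEnd ℂ) (ek ξ x) :=
  Complex.continuous_conj.comp (continuous_ek _)

lemma continuous_pderiv {f : R3 → ℂ} (hf : ContDiff ℝ ∞ f) (j : Fin 3) :
    Continuous (pderiv j f) :=
  (hf.continuous_fderiv (by simp)).clm_apply continuous_const

/-- Integration by parts. The twists cancel in conj(e_{κ+2πk}) e_κ φ, which is periodic, so its
derivative has mean zero; then expand by Leibniz. -/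
lemma integral_ek_mul_pderiv {μ : Measure R3} [IsFiniteMeasure (μ.restrict cellQ)]
    (hmean : IsDerivMeanFree μ)
    (κ : R3) (k : Fin 3 → ℤ) (j : Fin 3) {φ : R3 → ℂ} (hφ : SmoothPer φ) :
    ∫ x in cellQ, (starRingEnd ℂ) (ek (shift κ k) x) * pderiv j (fun y => ek κ y * φ y) x ∂μ
      = Complex.I * shift κ k j *
        ∫ x in cellQ, (starRingEnd ℂ) (ek (shift κ k) x) * (ek κ x * φ x) ∂μ := by
  have hf : ContDiff ℝ ∞ fun y => ek κ y * φ y := (contDiff_ek κ).mul hφ.1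
  have key : ∀ x, (starRingEnd ℂ) (ek (shift κ k) x) * (ek κ x * φ x)
      = ek (shift 0 (-k)) x * φ x := fun x => by
    rw [conj_ek, shift_eq_add, ← mul_assoc, ← ek_add, ← neg_shift_zero]
    congr 2; abel
  have h := hmean _ ((smoothPer_ek_shift_zero (-k)).mul hφ) j
  have e : ∀ x, pderiv j (fun y => ek (shift 0 (-k)) y * φ y) x =
      (starRingEnd ℂ) (ek (shift κ k) x) * pderiv j (fun y => ek κ y * φ y) x
      - Complex.I * shift κ k j * ((starRingEnd ℂ) (ek (shift κ k) x) * (ek κ x * φ x)) := by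
    intro x
    simp_rw [← key, conj_ek]
    rw [pderiv_mul j ((contDiff_ek _).differentiable (by simp) x) (hf.differentiable (by simp) x),
      pderiv_ek]
    simp
    ring
  simp_rw [e] at h
  have c1 := continuous_conj_ek (shift κ k)
  rw [integral_sub, integral_const_mul, sub_eq_zero] at h
  · exact h
  · exact integrable_of_continuous (c1.mul (continuous_pderiv hf j))
  · exact (integrable_of_continuous (c1.mul hf.continuous)).const_mul _

/-! ### Multiplication operators and plane waves -/

lemma act_eq_sum (M : Matrix (Fin 3) (Fin 3) ℝ) (v : C3) :
    act M v = ∑ i, ∑ j, ((M i j : ℂ) * v j) • EuclideanSpace.single i (1 : ℂ) := by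
  ext k
  fin_cases k <;> simp [act, Matrix.mulVec, dotProduct, Fin.sum_univ_three]

lemma aestronglyMeasurable_act {ρ : Measure R3} {M : R3 → Matrix (Fin 3) (Fin 3) ℝ}
    (hM : Continuous M) {u : R3 → C3} (hu : AEStronglyMeasurable u ρ) :
    AEStronglyMeasurable (fun x => act (M x) (u x)) ρ := by
  simp_rw [act_eq_sum]
  refine Finset.aestronglyMeasurable_fun_sum _ fun i _ =>
    Finset.aestronglyMeasurable_fun_sum _ fun j _ => ?_
  have h1 : Continuous fun x => ((M x i j : ℝ) : ℂ) :=
    Complex.continuous_ofReal.comp (hM.matrix_elem i j)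
  have h2 : AEStronglyMeasurable (fun x => u x j) ρ :=
    (PiLp.continuous_apply 2 _ j).comp_aestronglyMeasurable hu
  exact (h1.aestronglyMeasurable.mul h2).smul_const _

lemma exists_mulOperator {μ : Measure R3} {M : R3 → Matrix (Fin 3) (Fin 3) ℝ} (hM : Continuous M) :
    ∃ T : L2Q C3 μ →L[ℂ] L2Q C3 μ, ∀ u : L2Q C3 μ,
      T u =ᵐ[μ.restrict cellQ] fun x => act (M x) (u x) := by
  obtain ⟨C, hC0, hC⟩ := exists_norm_act_le hM
  have hae : ∀ u : R3 → C3, ∀ᵐ x ∂(μ.restrict cellQ), ‖act (M x) (u x)‖ ≤ C * ‖u x‖ := fun u =>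
    (ae_restrict_mem measurableSet_cellQ).mono fun x hx => hC x hx _
  have hmeas : ∀ u : L2Q C3 μ, MemLp (fun x => act (M x) (u x)) 2 (μ.restrict cellQ) := fun u => by
    refine (Lp.memLp u).of_le_mul (c := C) ?_ (hae u)
    exact aestronglyMeasurable_act hM (Lp.aestronglyMeasurable u)
  let T : L2Q C3 μ →ₗ[ℂ] L2Q C3 μ :=
    { toFun := fun u => (hmeas u).toLp
      map_add' := fun u v => by
        rw [← MemLp.toLp_add]
        refine MemLp.toLp_congr _ _ ?_
        filter_upwards [Lp.coeFn_add u v] with x hx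
        simp only [hx, Pi.add_apply, act_add]
      map_smul' := fun c u => by
        rw [RingHom.id_apply, ← MemLp.toLp_const_smul]
        refine MemLp.toLp_congr _ _ ?_
        filter_upwards [Lp.coeFn_smul c u] with x hx
        simp only [hx, Pi.smul_apply, act_smul] }
  refine ⟨T.mkContinuous C fun u => ?_, fun u => (hmeas u).coeFn_toLp⟩
  refine Lp.norm_le_mul_norm_of_ae_le_mul ?_
  filter_upwards [(hmeas u).coeFn_toLp, hae u] with x hx h
  have : T u x = act (M x) (u x) := hx
  rwa [this]

variable {μ : Measure R3}

lemma memLp_planeWave [IsFiniteMeasure (μ.restrict cellQ)] (ξ : R3) (v : C3) :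
    MemLp (fun x => ek ξ x • v) 2 (μ.restrict cellQ) :=
  MemLp.of_bound ((continuous_ek ξ).smul continuous_const).aestronglyMeasurable ‖v‖
    (Filter.Eventually.of_forall fun x => by simp [norm_smul, norm_ek])

/-- The plane waves `e_ξ v`, as a map from amplitudes `v` to `L²`. -/
def planeWave (μ : Measure R3) [IsFiniteMeasure (μ.restrict cellQ)] (ξ : R3) :
    C3 →L[ℂ] L2Q C3 μ :=
  LinearMap.toContinuousLinearMap
    { toFun := fun v => (memLp_planeWave ξ v).toLp
      map_add' := fun u v => by
        rw [← MemLp.toLp_add]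
        exact MemLp.toLp_congr _ _ (Filter.Eventually.of_forall fun x => by simp)
      map_smul' := fun c v => by
        rw [RingHom.id_apply, ← MemLp.toLp_const_smul]
        exact MemLp.toLp_congr _ _ (Filter.Eventually.of_forall fun x => smul_comm _ _ _) }

/-- The Fourier coefficient of a vector field at the frequency `ξ`. -/
def coef (μ : Measure R3) [IsFiniteMeasure (μ.restrict cellQ)] (ξ : R3) : L2Q C3 μ →L[ℂ] C3 :=
  (planeWave μ ξ).adjoint

lemma coeFn_planeWave [IsFiniteMeasure (μ.restrict cellQ)] (ξ : R3) (v : C3) :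
    planeWave μ ξ v =ᵐ[μ.restrict cellQ] fun x => ek ξ x • v :=
  (memLp_planeWave ξ v).coeFn_toLp

lemma inner_coef [IsFiniteMeasure (μ.restrict cellQ)] (ξ : R3) (v : C3) (u : L2Q C3 μ) :
    inner ℂ v (coef μ ξ u) = inner ℂ (planeWave μ ξ v) u :=
  ContinuousLinearMap.adjoint_inner_right _ _ _

lemma inner_planeWave [IsFiniteMeasure (μ.restrict cellQ)] (ξ : R3) (v : C3) (u : L2Q C3 μ) :
    inner ℂ (planeWave μ ξ v) u
      = ∫ x in cellQ, (starRingEnd ℂ) (ek ξ x) * inner ℂ v (u x) ∂μ := by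
  rw [L2.inner_def]
  refine integral_congr_ae ?_
  filter_upwards [coeFn_planeWave ξ v] with x hx
  rw [hx, inner_smul_left]

lemma coef_apply [IsFiniteMeasure (μ.restrict cellQ)] (ξ : R3) (u : L2Q C3 μ) (i : Fin 3) :
    coef μ ξ u i = ∫ x in cellQ, (starRingEnd ℂ) (ek ξ x) * u x i ∂μ := by
  have h := inner_coef ξ (EuclideanSpace.single i (1 : ℂ)) u
  rw [inner_planeWave] at h
  simpa [EuclideanSpace.inner_single_left] using h

/-- The product conj(e_{κ+2πk}) e_{κ+2πl} is the periodic exponential of index l - k, independent of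
κ, so its mean is known. -/
lemma coef_planeWave [IsProbabilityMeasure (μ.restrict cellQ)]
    (hmean : IsDerivMeanFree μ)
    (κ : R3) (k l : Fin 3 → ℤ) (v : C3) :
    coef μ (shift κ k) (planeWave μ (shift κ l) v) = if k = l then v else 0 := by
  ext i
  rw [coef_apply]
  have : ∫ x in cellQ, (starRingEnd ℂ) (ek (shift κ k) x) * planeWave μ (shift κ l) v x i ∂μ
      = ∫ x in cellQ, ek (shift 0 (l - k)) x * v i ∂μ := by
    refine integral_congr_ae ?_
    filter_upwards [coeFn_planeWave (shift κ l) v] with x hx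
    rw [hx, conj_ek, PiLp.smul_apply, smul_eq_mul, ← mul_assoc, ← ek_add]
    congr 2
    ext j
    simp [shift_apply]
    ring
  rw [this, integral_mul_const, integral_ek_shift_zero hmean]
  by_cases h : k = l
  · simp [h]
  · rw [if_neg h, if_neg (by rwa [sub_eq_zero, eq_comm])]
    simp

/-! ### Completeness of the exponentials, by transport to the torus -/

/-- The projection of `ℝ³` onto the torus. -/
def torusMk (x : R3) : UnitAddTorus (Fin 3) := fun i => (x i : UnitAddCircle)

/-- The representative in the cell `Q` of a point of the torus. -/
def torusRep (t : UnitAddTorus (Fin 3)) : R3 :=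
  WithLp.toLp 2 fun i => (AddCircle.equivIco (1 : ℝ) 0 (t i) : ℝ)

lemma measurable_torusMk : Measurable torusMk :=
  measurable_pi_lambda _ fun i =>
    AddCircle.measurable_mk'.comp (PiLp.continuous_apply 2 _ i).measurable

lemma measurable_torusRep : Measurable torusRep :=
  (WithLp.measurable_toLp 2 (Fin 3 → ℝ)).comp <| measurable_pi_lambda _ fun i =>
    (measurable_subtype_coe.comp (AddCircle.measurableEquivIco (1 : ℝ) 0).measurable).comp
      (measurable_pi_apply i)

lemma torusRep_torusMk {x : R3} (hx : x ∈ cellQ) : torusRep (torusMk x) = x := by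
  ext i
  exact AddCircle.equivIco_coe_of_mem (by simpa using hx i)

lemma mFourier_torusMk (k : Fin 3 → ℤ) (x : R3) :
    UnitAddTorus.mFourier k (torusMk x) = ek (shift 0 k) x := by
  simp only [UnitAddTorus.mFourier, torusMk, ContinuousMap.coe_mk, fourier_coe_apply, ek,
    ← Complex.exp_sum, shift_apply]
  congr 1
  push_cast
  rw [Finset.mul_sum]
  refine Finset.sum_congr rfl fun i _ => ?_
  simp
  ring

lemma measurePreserving_torusRep :
    MeasurePreserving torusRep ((μ.restrict cellQ).map torusMk) (μ.restrict cellQ) := by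
  refine ⟨measurable_torusRep, ?_⟩
  rw [Measure.map_map measurable_torusRep measurable_torusMk]
  conv_rhs => rw [← Measure.map_id (μ := μ.restrict cellQ)]
  exact Measure.map_congr ((ae_restrict_mem measurableSet_cellQ).mono fun x hx =>
    torusRep_torusMk hx)

/-- The cell is not compact, so the measure is pushed to the torus, where the span of the characters
is uniformly dense in the continuous functions and these are dense in L². No property of μ beyond
finiteness on the cell enters. -/
lemma ae_eq_zero_of_integral_ek_mul [IsFiniteMeasure (μ.restrict cellQ)] {h : R3 → ℂ}
    (hh : MemLp h 2 (μ.restrict cellQ))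
    (h0 : ∀ k, ∫ x in cellQ, ek (shift 0 k) x * h x ∂μ = 0) : h =ᵐ[μ.restrict cellQ] 0 := by
  set ν := (μ.restrict cellQ).map torusMk with hν
  have hmp : MeasurePreserving torusRep ν (μ.restrict cellQ) := measurePreserving_torusRep
  have hL : MemLp (h ∘ torusRep) 2 ν := hh.comp_measurePreserving hmp
  have : IsFiniteMeasure ν := by rw [hν]; infer_instance
  have hcoef : ∀ k, ∫ t, UnitAddTorus.mFourier k t * h (torusRep t) ∂ν = 0 := fun k => by
    rw [hν, integral_map measurable_torusMk.aemeasurable, ← h0 k]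
    · refine integral_congr_ae ((ae_restrict_mem measurableSet_cellQ).mono fun x hx => ?_)
      simp only [mFourier_torusMk, torusRep_torusMk hx]
    · exact (UnitAddTorus.mFourier k).continuous.aestronglyMeasurable.mul hL.1
  have hker : ∀ φ : C(UnitAddTorus (Fin 3), ℂ),
      inner ℂ (hL.toLp) (ContinuousMap.toLp (E := ℂ) 2 ν ℂ φ) = 0 := by
    let B : C(UnitAddTorus (Fin 3), ℂ) →L[ℂ] ℂ :=
      (innerSL ℂ hL.toLp).comp (ContinuousMap.toLp (E := ℂ) 2 ν ℂ)
    have hB : (⊤ : Submodule ℂ C(UnitAddTorus (Fin 3), ℂ)) ≤ B.ker := by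
      rw [← UnitAddTorus.span_mFourier_closure_eq_top]
      refine Submodule.topologicalClosure_minimal _ ?_ B.isClosed_ker
      rw [Submodule.span_le]
      rintro _ ⟨k, rfl⟩
      change inner ℂ hL.toLp (ContinuousMap.toLp (E := ℂ) 2 ν ℂ _) = 0
      -- Conjugating a character negates its index, hence the coefficient at -k.
      rw [← inner_conj_symm, map_eq_zero, L2.inner_def, ← hcoef (-k)]
      refine integral_congr_ae ?_
      filter_upwards [hL.coeFn_toLp, ContinuousMap.coeFn_toLp (𝕜 := ℂ) (p := 2) ν
        (UnitAddTorus.mFourier k)] with t h1 h2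
      rw [h1, h2, UnitAddTorus.mFourier_neg, RCLike.inner_apply, mul_comm]
      rfl
    exact fun φ => hB (Submodule.mem_top (x := φ))
  have hzero : hL.toLp = 0 := by
    have hd : DenseRange (ContinuousMap.toLp (E := ℂ) 2 ν ℂ) :=
      ContinuousMap.toLp_denseRange _ _ _ (by norm_num)
    rw [← inner_self_eq_zero (𝕜 := ℂ)]
    exact hd.induction_on (p := fun z => inner ℂ hL.toLp z = 0) hL.toLp
      (isClosed_eq (continuous_const.inner continuous_id) continuous_const) hker
  have hae : ∀ᵐ t ∂ν, h (torusRep t) = 0 := by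
    filter_upwards [hL.coeFn_toLp, Lp.coeFn_zero ℂ 2 ν] with t h1 h2
    rw [← Function.comp_apply (f := h), ← h1, hzero, h2, Pi.zero_apply]
  filter_upwards [ae_of_ae_map measurable_torusMk.aemeasurable hae,
    ae_restrict_mem measurableSet_cellQ] with x hx hxQ
  rwa [torusRep_torusMk hxQ] at hx

/-- Removing the unimodular factor e_κ from each component reduces the claim to untwisted Fourier
uniqueness. -/
lemma eq_zero_of_coef_eq_zero [IsFiniteMeasure (μ.restrict cellQ)] (κ : R3) {u : L2Q C3 μ}
    (hu : ∀ k, coef μ (shift κ k) u = 0) : u = 0 := by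
  have hi : ∀ i : Fin 3, ∀ᵐ x ∂(μ.restrict cellQ), u x i = 0 := fun i => by
    have hm : MemLp (fun x => (starRingEnd ℂ) (ek κ x) * u x i) 2 (μ.restrict cellQ) := by
      refine (Lp.memLp u).of_le ?_ (Filter.Eventually.of_forall fun x => ?_)
      · exact (continuous_conj_ek κ).aestronglyMeasurable.mul
          ((PiLp.continuous_apply 2 _ i).comp_aestronglyMeasurable (Lp.aestronglyMeasurable u))
      · simpa [norm_ek] using PiLp.norm_apply_le (u x) i
    have := ae_eq_zero_of_integral_ek_mul hm fun k => by
      have h := congrArg (fun v : C3 => v i) (hu (-k))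
      simp only [coef_apply] at h
      rw [← PiLp.zero_apply (p := 2) (β := fun _ : Fin 3 => ℂ) i, ← h]
      refine integral_congr_ae (Filter.Eventually.of_forall fun x => ?_)
      simp only [conj_ek]
      rw [← mul_assoc, ← ek_add, shift_eq_add κ, neg_add, neg_shift_zero, neg_neg, add_comm]
    filter_upwards [this] with x hx
    have hne : (starRingEnd ℂ) (ek κ x) ≠ 0 := left_ne_zero_of_mul_eq_one (conj_ek_mul_self κ x)
    exact (mul_eq_zero.1 hx).resolve_left hne
  rw [Lp.eq_zero_iff_ae_eq_zero]
  filter_upwards [hi 0, hi 1, hi 2] with x h0 h1 h2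
  ext i
  fin_cases i <;> simpa

/-- **Parseval's identity** for the twisted Fourier series of vector fields. -/
lemma hasSum_inner_coef [IsProbabilityMeasure (μ.restrict cellQ)]
    (hmean : IsDerivMeanFree μ)
    (κ : R3) (u v : L2Q C3 μ) :
    HasSum (fun k : Fin 3 → ℤ => inner ℂ (coef μ (shift κ k) u) (coef μ (shift κ k) v))
      (inner ℂ u v) := by
  let b : OrthonormalBasis (Fin 3) ℂ C3 := EuclideanSpace.basisFun (Fin 3) ℂ
  let w : (Fin 3 → ℤ) × Fin 3 → L2Q C3 μ := fun p => planeWave μ (shift κ p.1) (b p.2)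
  have hw : Orthonormal ℂ w := by
    rw [orthonormal_iff_ite]
    rintro ⟨k, i⟩ ⟨l, j⟩
    change inner ℂ (planeWave μ (shift κ k) (b i)) (planeWave μ (shift κ l) (b j)) = _
    rw [← inner_coef, coef_planeWave hmean]
    by_cases h : k = l
    · simp [h, orthonormal_iff_ite.1 b.orthonormal]
    · simp [h]
  have hbot : (Submodule.span ℂ (Set.range w))ᗮ = ⊥ := by
    rw [eq_bot_iff]
    intro z hz
    rw [Submodule.mem_bot]
    refine eq_zero_of_coef_eq_zero κ fun k => ?_
    ext i
    have hi : inner ℂ (b i) (coef μ (shift κ k) z) = 0 := by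
      rw [inner_coef]
      exact (Submodule.mem_orthogonal _ _).1 hz _ (Submodule.subset_span ⟨(k, i), rfl⟩)
    simpa [b, EuclideanSpace.inner_single_left] using hi
  have h := (HilbertBasis.mkOfOrthogonalEqBot hw hbot).hasSum_inner_mul_inner u v
  -- The Hilbert basis is indexed by frequency and direction; summing first over the three
  -- directions gives the inner product of the coefficients in ℂ³.
  have h' := h.prod_fiberwise fun k => hasSum_fintype _
  simp only [HilbertBasis.coe_mkOfOrthogonalEqBot] at h'
  refine h'.congr_fun fun k => ?_
  rw [← b.sum_inner_mul_inner]
  refine Finset.sum_congr rfl fun i _ => ?_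
  rw [inner_coef, ← inner_conj_symm (coef μ _ u), inner_coef, inner_conj_symm]

/-! ### Vector calculus -/

/-- A complex matrix acting on a complex vector. -/
def cact (M : Matrix (Fin 3) (Fin 3) ℂ) (v : C3) : C3 := WithLp.toLp 2 (M.mulVec v.ofLp)

/-- A real vector, seen as a complex vector. -/
def toC3 (ξ : R3) : C3 := WithLp.toLp 2 fun i => (ξ i : ℂ)

lemma cact_crossI (ξ : R3) (v : C3) :
    cact (crossI ξ) v = !₂[Complex.I * ξ 1 * v 2 - Complex.I * ξ 2 * v 1,
      Complex.I * ξ 2 * v 0 - Complex.I * ξ 0 * v 2,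
      Complex.I * ξ 0 * v 1 - Complex.I * ξ 1 * v 0] := by
  ext i
  fin_cases i <;> simp [cact, crossI, LinearMap.toMatrix'_mulVec, cross_apply]

lemma continuous_cact (M : Matrix (Fin 3) (Fin 3) ℂ) : Continuous (cact M) :=
  (PiLp.continuous_toLp 2 _).comp (continuous_const.matrix_mulVec (PiLp.continuous_ofLp 2 _))

lemma cact_mul (M N : Matrix (Fin 3) (Fin 3) ℂ) (v : C3) : cact (M * N) v = cact M (cact N v) := by
  simp [cact, Matrix.mulVec_mulVec]

lemma cact_add (M N : Matrix (Fin 3) (Fin 3) ℂ) (v : C3) : cact (M + N) v = cact M v + cact N v := by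
  simp [cact, Matrix.add_mulVec]

lemma crossI_smul (c : ℝ) (ξ : R3) : crossI (c • ξ) = (c : ℂ) • crossI ξ := by
  unfold crossI
  rw [← map_smul, ← map_smul]
  congr 2
  ext i
  simp
  ring

lemma cact_smul (c : ℂ) (M : Matrix (Fin 3) (Fin 3) ℂ) (v : C3) : cact (c • M) v = c • cact M v := by
  simp [cact, Matrix.smul_mulVec]

/-- The cross product with a real vector is antisymmetric, so the factor i makes it Hermitian. -/
lemma inner_cact_crossI (ξ : R3) (u v : C3) :
    inner ℂ (cact (crossI ξ) u) v = inner ℂ u (cact (crossI ξ) v) := by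
  simp [cact_crossI, PiLp.inner_apply, Fin.sum_univ_three]
  ring

/-- This is iξ × iξ × v = |ξ|² v - (ξ·v) ξ with the last term absent. -/
lemma cact_crossI_crossI {ξ : R3} {v : C3} (h : inner ℂ (toC3 ξ) v = (0 : ℂ)) :
    cact (crossI ξ) (cact (crossI ξ) v) = ((‖ξ‖ ^ 2 : ℝ) : ℂ) • v := by
  simp [toC3, PiLp.inner_apply, Fin.sum_univ_three] at h
  rw [EuclideanSpace.norm_sq_eq]
  ext i
  fin_cases i <;> simp [cact_crossI, Fin.sum_univ_three]
  · linear_combination Complex.I ^ 2 * ξ 0 * h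
      - ((ξ 0 : ℂ) ^ 2 + (ξ 1 : ℂ) ^ 2 + (ξ 2 : ℂ) ^ 2) * v 0 * Complex.I_sq
  · linear_combination Complex.I ^ 2 * ξ 1 * h
      - ((ξ 0 : ℂ) ^ 2 + (ξ 1 : ℂ) ^ 2 + (ξ 2 : ℂ) ^ 2) * v 1 * Complex.I_sq
  · linear_combination Complex.I ^ 2 * ξ 2 * h
      - ((ξ 0 : ℂ) ^ 2 + (ξ 1 : ℂ) ^ 2 + (ξ 2 : ℂ) ^ 2) * v 2 * Complex.I_sq

/-- On transversal v the square of iξ× is |ξ|², so |ξ|² ⟨u, v⟩ = ⟨iξ×u, iξ×v⟩ with |iξ×v| = |ξ||v|.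
Only v has to be transversal; u is seen only through its curl. -/
lemma norm_inner_le_of_transversal {ξ : R3} {r : ℝ} (hr : 0 < r) (hξ : r ≤ ‖ξ‖) (u : C3) {v : C3}
    (h : inner ℂ (toC3 ξ) v = (0 : ℂ)) :
    ‖(inner ℂ u v : ℂ)‖ ≤ ‖cact (crossI ξ) u‖ * ‖v‖ / r := by
  have hpos : 0 < ‖ξ‖ := hr.trans_le hξ
  have h1 : ((‖ξ‖ ^ 2 : ℝ) : ℂ) * inner ℂ u v
      = inner ℂ (cact (crossI ξ) u) (cact (crossI ξ) v) := by
    rw [inner_cact_crossI, cact_crossI_crossI h, inner_smul_right]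
  have h2 : ‖cact (crossI ξ) v‖ ^ 2 = (‖ξ‖ * ‖v‖) ^ 2 := by
    have : (inner ℂ (cact (crossI ξ) v) (cact (crossI ξ) v) : ℂ)
        = ((‖ξ‖ ^ 2 : ℝ) : ℂ) * inner ℂ v v := by
      rw [inner_cact_crossI, cact_crossI_crossI h, inner_smul_right]
    rw [inner_self_eq_norm_sq_to_K, inner_self_eq_norm_sq_to_K] at this
    rw [mul_pow]
    apply Complex.ofReal_injective
    simpa using this
  have h3 : ‖cact (crossI ξ) v‖ = ‖ξ‖ * ‖v‖ :=
    (sq_eq_sq₀ (norm_nonneg _) (by positivity)).1 h2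
  have h4 : ‖ξ‖ ^ 2 * ‖(inner ℂ u v : ℂ)‖ ≤ ‖cact (crossI ξ) u‖ * (‖ξ‖ * ‖v‖) := by
    rw [← h3]
    refine le_trans (le_of_eq ?_) (norm_inner_le_norm (𝕜 := ℂ) _ _)
    rw [← h1, norm_mul, Complex.norm_real, Real.norm_of_nonneg (by positivity)]
  rw [le_div_iff₀ hr]
  have h5 : ‖ξ‖ * ‖(inner ℂ u v : ℂ)‖ ≤ ‖cact (crossI ξ) u‖ * ‖v‖ := by
    refine le_of_mul_le_mul_left ?_ hpos
    linarith
  nlinarith [norm_nonneg (inner ℂ u v : ℂ)]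

/-- In a coordinate with k_j ≠ 0, |2πk_j| ≥ 2π while |κ_j| ≤ π. This spectral gap is the source of
the factor ε in the estimate. -/
lemma pi_le_norm_shift {κ : R3} (hκ : κ ∈ dualQ) {k : Fin 3 → ℤ} (hk : k ≠ 0) :
    Real.pi ≤ ‖shift κ k‖ := by
  obtain ⟨j, hj⟩ := Function.ne_iff.1 hk
  refine le_trans ?_ (PiLp.norm_apply_le (shift κ k) j)
  rw [shift_apply, Real.norm_eq_abs, le_abs']
  obtain ⟨h1, h2⟩ := hκ j
  rcases lt_or_gt_of_ne hj with h | h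
  · left
    have : (k j : ℝ) ≤ -1 := by exact_mod_cast Int.le_sub_one_of_lt h
    nlinarith [Real.pi_pos]
  · right
    have : (1 : ℝ) ≤ k j := by exact_mod_cast h
    nlinarith [Real.pi_pos]

lemma isUnit_of_coercive {M : Matrix (Fin 3) (Fin 3) ℂ} {α : ℝ} (hα : 0 < α)
    (h : ∀ v : C3, α * ‖v‖ ^ 2 ≤ (inner ℂ v (cact M v) : ℂ).re) : IsUnit M := by
  rw [← Matrix.mulVec_injective_iff_isUnit]
  refine (injective_iff_map_eq_zero M.mulVecLin).2 fun v hv => ?_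
  have h1 := h (WithLp.toLp 2 v)
  have h2 : cact M (WithLp.toLp 2 v) = 0 := by
    simp only [cact]
    rw [← Matrix.mulVecLin_apply, hv, WithLp.toLp_zero]
  rw [h2, inner_zero_right, Complex.zero_re] at h1
  have h3 : ‖(WithLp.toLp 2 v : C3)‖ = 0 := by
    have := pow_nonneg (norm_nonneg (WithLp.toLp 2 v : C3)) 2
    exact pow_eq_zero_iff (two_ne_zero) |>.1 (le_antisymm (by nlinarith) this)
  simpa using norm_eq_zero.1 h3

lemma contDiff_apply_C3 {F : R3 → C3} (hF : ContDiff ℝ ∞ F) (i : Fin 3) :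
    ContDiff ℝ ∞ fun x => F x i :=
  contDiff_piLp 2 |>.1 hF i

lemma contDiff_pderiv {f : R3 → ℂ} (hf : ContDiff ℝ ∞ f) (j : Fin 3) : ContDiff ℝ ∞ (pderiv j f) :=
  (hf.fderiv_right (m := ∞) (by simp)).clm_apply contDiff_const

lemma SmoothPer.pderiv {f : R3 → ℂ} (hf : SmoothPer f) (j : Fin 3) : SmoothPer (pderiv j f) := by
  refine ⟨contDiff_pderiv hf.1 j, fun i x => ?_⟩
  simp only [Maxwell.pderiv]
  rw [← fderiv_comp_add_right]
  congr 2
  exact funext (hf.2 i)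

lemma SmoothPer.apply {F : R3 → C3} (hF : SmoothPer F) (i : Fin 3) : SmoothPer fun x => F x i :=
  ⟨contDiff_apply_C3 hF.1 i, fun j x => by simp only [hF.2 j x]⟩

lemma pderiv_comm {f : R3 → ℂ} (hf : ContDiff ℝ ∞ f) (i j : Fin 3) (x : R3) :
    pderiv i (pderiv j f) x = pderiv j (pderiv i f) x := by
  have hd : DifferentiableAt ℝ (fderiv ℝ f) x :=
    (hf.fderiv_right (m := ∞) (by simp)).differentiable (by simp) x
  have h : ∀ a b : Fin 3, pderiv a (pderiv b f) x
      = fderiv ℝ (fderiv ℝ f) x (stdVec a) (stdVec b) := fun a b => by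
    change fderiv ℝ (fun y => fderiv ℝ f y (stdVec b)) x (stdVec a) = _
    rw [fderiv_clm_apply hd (differentiableAt_const _)]
    simp
  rw [h, h]
  exact (hf.contDiffAt.isSymmSndFDerivAt (by
    rw [minSmoothness_of_isRCLikeNormedField]
    exact WithTop.coe_le_coe.2 (le_top (a := (2 : ℕ∞))))) _ _

lemma curl_grad {f : R3 → ℂ} (hf : ContDiff ℝ ∞ f) (x : R3) : curl (grad f) x = 0 := by
  have h : ∀ i, (fun y => grad f y i) = pderiv i f := fun i => rfl
  ext i
  fin_cases i <;> simp [curl, h, pderiv_comm hf 1 2, pderiv_comm hf 0 2, pderiv_comm hf 0 1]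

lemma pderiv_add (j : Fin 3) {f h : R3 → ℂ} (hf : ContDiff ℝ ∞ f) (hh : ContDiff ℝ ∞ h) (x : R3) :
    pderiv j (fun y => f y + h y) x = pderiv j f x + pderiv j h x := by
  simp only [pderiv]
  rw [fderiv_fun_add (hf.differentiable (by simp) x) (hh.differentiable (by simp) x)]
  rfl

lemma pderiv_const_mul (j : Fin 3) (c : ℂ) {f : R3 → ℂ} (hf : ContDiff ℝ ∞ f) (x : R3) :
    pderiv j (fun y => c * f y) x = c * pderiv j f x := by
  simp only [pderiv]
  rw [fderiv_const_mul (hf.differentiable (by simp) x)]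
  rfl

lemma curl_add {F H : R3 → C3} (hF : ContDiff ℝ ∞ F) (hH : ContDiff ℝ ∞ H) (x : R3) :
    curl (fun y => F y + H y) x = curl F x + curl H x := by
  ext i
  fin_cases i <;>
  · simp [curl, pderiv_add _ (contDiff_apply_C3 hF _) (contDiff_apply_C3 hH _)]
    ring

lemma curl_const_smul (c : ℂ) {F : R3 → C3} (hF : ContDiff ℝ ∞ F) (x : R3) :
    curl (fun y => c • F y) x = c • curl F x := by
  ext i
  fin_cases i <;>
  · simp [curl, pderiv_const_mul _ c (contDiff_apply_C3 hF _)]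
    ring

lemma curl_ek_smul_const (κ : R3) (v : C3) (x : R3) :
    curl (fun y => ek κ y • v) x = ek κ x • cact (crossI κ) v := by
  have h : ∀ i j, pderiv j (fun y => (ek κ y • v) i) x = v i * (Complex.I * κ j * ek κ x) := by
    intro i j
    rw [← pderiv_ek, ← pderiv_const_mul j _ (contDiff_ek κ)]
    simp [mul_comm]
  ext i
  simp only [curl, h, cact_crossI]
  fin_cases i <;> simp <;> ring

variable {A : R3 → Matrix (Fin 3) (Fin 3) ℝ} {κ : R3}

/-! ### The Sobolev spaces -/

lemma contDiff_ek_mul {φ : R3 → ℂ} (hφ : SmoothPer φ) (κ : R3) :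
    ContDiff ℝ ∞ fun x => ek κ x * φ x := (contDiff_ek κ).mul hφ.1

lemma contDiff_ek_smul {F : R3 → C3} (hF : SmoothPer F) (κ : R3) :
    ContDiff ℝ ∞ fun x => ek κ x • F x := (contDiff_ek κ).smul hF.1

/-- The pairs `(e_κ φ, curl(e_κ A^{1/2} φ))` with `A^{1/2} φ` smooth and periodic. -/
def curlPairs (μ : Measure R3) (A : R3 → Matrix (Fin 3) (Fin 3) ℝ) (κ : R3) :
    Submodule ℂ (L2Q C3 μ × L2Q C3 μ) where
  carrier := {p | ∃ φ : R3 → C3, SmoothPer (fun x => act (sqrtField A x) (φ x)) ∧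
    p.1 =ᵐ[μ.restrict cellQ] (fun x => ek κ x • φ x) ∧
    p.2 =ᵐ[μ.restrict cellQ] curl (fun x => ek κ x • act (sqrtField A x) (φ x))}
  add_mem' := by
    rintro p q ⟨φ, hφ, hp1, hp2⟩ ⟨χ, hχ, hq1, hq2⟩
    refine ⟨fun x => φ x + χ x, ⟨?_, fun i x => ?_⟩, ?_, ?_⟩
    · simp only [act_add]; exact hφ.1.add hχ.1
    · simp only [act_add]
      exact congrArg₂ (· + ·) (hφ.2 i x) (hχ.2 i x)
    · filter_upwards [hp1, hq1, Lp.coeFn_add p.1 q.1] with x h1 h2 h3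
      rw [Prod.fst_add, h3, Pi.add_apply, h1, h2, smul_add]
    · filter_upwards [hp2, hq2, Lp.coeFn_add p.2 q.2] with x h1 h2 h3
      rw [Prod.snd_add, h3, Pi.add_apply, h1, h2,
        ← curl_add (contDiff_ek_smul hφ κ) (contDiff_ek_smul hχ κ)]
      simp only [act_add, smul_add]
  zero_mem' := by
    refine ⟨fun _ => 0, ⟨?_, fun i x => ?_⟩, ?_, ?_⟩
    · simp [act, contDiff_const]
    · simp [act]
    · filter_upwards [Lp.coeFn_zero C3 2 (μ.restrict cellQ)] with x h
      rw [Prod.fst_zero, h, Pi.zero_apply, smul_zero]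
    · filter_upwards [Lp.coeFn_zero C3 2 (μ.restrict cellQ)] with x h
      rw [Prod.snd_zero, h]
      ext i
      fin_cases i <;> simp [curl, pderiv, act]
  smul_mem' := by
    rintro c p ⟨φ, hφ, hp1, hp2⟩
    refine ⟨fun x => c • φ x, ⟨?_, fun i x => ?_⟩, ?_, ?_⟩
    · simp only [act_smul]; exact hφ.1.const_smul c
    · simp only [act_smul]
      exact congrArg (c • ·) (hφ.2 i x)
    · filter_upwards [hp1, Lp.coeFn_smul c p.1] with x h1 h3
      rw [Prod.smul_fst, h3, Pi.smul_apply, h1, smul_comm]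
    · filter_upwards [hp2, Lp.coeFn_smul c p.2] with x h1 h3
      rw [Prod.smul_snd, h3, Pi.smul_apply, h1, ← curl_const_smul c (contDiff_ek_smul hφ κ)]
      simp only [act_smul, smul_comm c]

lemma Hcurl_eq (μ : Measure R3) (A : R3 → Matrix (Fin 3) (Fin 3) ℝ) (κ : R3) :
    Hcurl μ A κ = ((curlPairs μ A κ).topologicalClosure : Set (L2Q C3 μ × L2Q C3 μ)) := rfl

lemma coef_curl [IsProbabilityMeasure (μ.restrict cellQ)] (hmean : IsDerivMeanFree μ)
    {F : R3 → C3} (hF : SmoothPer F) {u w : L2Q C3 μ}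
    (hu : u =ᵐ[μ.restrict cellQ] fun x => ek κ x • F x)
    (hw : w =ᵐ[μ.restrict cellQ] curl fun x => ek κ x • F x) (k : Fin 3 → ℤ) :
    coef μ (shift κ k) w = cact (crossI (shift κ k)) (coef μ (shift κ k) u) := by
  have hc := continuous_conj_ek (shift κ k)
  have hi : ∀ i j, Integrable (fun x => (starRingEnd ℂ) (ek (shift κ k) x)
      * pderiv j (fun y => ek κ y * F y i) x) (μ.restrict cellQ) := fun i j =>
    integrable_of_continuous (hc.mul (continuous_pderiv (contDiff_ek_mul (hF.apply i) κ) j))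
  have hcu : ∀ i, coef μ (shift κ k) u i
      = ∫ x in cellQ, (starRingEnd ℂ) (ek (shift κ k) x) * (ek κ x * F x i) ∂μ := fun i => by
    rw [coef_apply]
    refine integral_congr_ae ?_
    filter_upwards [hu] with x hx
    rw [hx]
    simp
  have hcw : ∀ a b c d e : Fin 3, (∀ x, curl (fun x => ek κ x • F x) x e
        = pderiv a (fun y => ek κ y * F y b) x - pderiv c (fun y => ek κ y * F y d) x) →
      coef μ (shift κ k) w e = Complex.I * shift κ k a * coef μ (shift κ k) u b
        - Complex.I * shift κ k c * coef μ (shift κ k) u d := fun a b c d e h => by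
    rw [hcu, hcu, ← integral_ek_mul_pderiv hmean κ k a (hF.apply b),
      ← integral_ek_mul_pderiv hmean κ k c (hF.apply d), ← integral_sub (hi b a) (hi d c),
      coef_apply]
    refine integral_congr_ae ?_
    filter_upwards [hw] with x hx
    rw [hx, h, mul_sub]
  rw [cact_crossI]
  ext e
  fin_cases e
  · exact hcw 1 2 2 1 0 fun x => rfl
  · exact hcw 2 0 0 2 1 fun x => rfl
  · exact hcw 0 1 1 0 2 fun x => rfl

/-- The relation holds for smooth pairs and both sides are continuous, so it survives the closure.
-/
lemma coef_snd_of_mem_Hcurl [IsProbabilityMeasure (μ.restrict cellQ)] (hmean : IsDerivMeanFree μ)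
    {S : L2Q C3 μ →L[ℂ] L2Q C3 μ}
    (hS : ∀ u, S u =ᵐ[μ.restrict cellQ] fun x => act (sqrtField A x) (u x))
    {p : L2Q C3 μ × L2Q C3 μ} (hp : p ∈ Hcurl μ A κ) (k : Fin 3 → ℤ) :
    coef μ (shift κ k) p.2 = cact (crossI (shift κ k)) (coef μ (shift κ k) (S p.1)) := by
  refine closure_minimal (t := {p : L2Q C3 μ × L2Q C3 μ | coef μ (shift κ k) p.2
    = cact (crossI (shift κ k)) (coef μ (shift κ k) (S p.1))}) ?_ ?_ hp
  · rintro p ⟨φ, hφ, hp1, hp2⟩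
    refine coef_curl hmean hφ ?_ hp2 k
    filter_upwards [hS p.1, hp1] with x h1 h2
    rw [h1, h2, act_smul]
  · exact isClosed_eq ((coef μ _).continuous.comp continuous_snd)
      ((continuous_cact _).comp ((coef μ _).continuous.comp (S.continuous.comp continuous_fst)))

/-- For smooth φ the coefficient is iκ ∫ φ dμ, which vanishes by the zero-mean normalisation. -/
lemma coef_snd_of_mem_H1zero [IsProbabilityMeasure (μ.restrict cellQ)] (hmean : IsDerivMeanFree μ)
    {p : L2Q ℂ μ × L2Q C3 μ} (hp : p ∈ H1zero μ κ) :
    coef μ κ p.2 = 0 := by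
  refine closure_minimal (t := {p : L2Q ℂ μ × L2Q C3 μ | coef μ κ p.2 = 0}) ?_ ?_ hp
  · rintro p ⟨φ, hφ, hp1, hp2⟩
    ext i
    rw [coef_apply]
    have h := integral_ek_mul_pderiv hmean κ 0 i hφ.1
    rw [shift_zero_right] at h
    have h2 : ∀ x, (starRingEnd ℂ) (ek κ x) * (ek κ x * φ x) = φ x := fun x => by
      rw [← mul_assoc, conj_ek_mul_self, one_mul]
    simp_rw [h2] at h
    rw [hφ.2, mul_zero] at h
    rw [PiLp.zero_apply, ← h]
    refine integral_congr_ae ?_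
    filter_upwards [hp2] with x hx
    rw [hx]
    rfl
  · exact isClosed_eq ((coef μ _).continuous.comp continuous_snd) continuous_const

/-- Gradients of single exponentials, as test functions, turn the weak cell equation into
transversality at each nonzero k. -/
lemma exists_mem_H1zero_planeWave [IsProbabilityMeasure (μ.restrict cellQ)] (hmean : IsDerivMeanFree μ)
    {k : Fin 3 → ℤ} (hk : k ≠ 0) :
    ∃ p ∈ H1zero μ κ, p.2 = Complex.I • planeWave μ (shift κ k) (toC3 (shift κ k)) := by
  have hm : MemLp (fun x => ek κ x * ek (shift 0 k) x) 2 (μ.restrict cellQ) :=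
    MemLp.of_bound ((continuous_ek κ).mul (continuous_ek _)).aestronglyMeasurable 1
      (Filter.Eventually.of_forall fun x => by simp [norm_ek])
  refine ⟨(hm.toLp, Complex.I • planeWave μ (shift κ k) (toC3 (shift κ k))),
    subset_closure ⟨ek (shift 0 k), ⟨smoothPer_ek_shift_zero k, ?_⟩, hm.coeFn_toLp, ?_⟩, rfl⟩
  · rw [integral_ek_shift_zero hmean, if_neg hk]
  · filter_upwards [Lp.coeFn_smul Complex.I (planeWave μ (shift κ k) (toC3 (shift κ k))),
      coeFn_planeWave (μ := μ) (shift κ k) (toC3 (shift κ k))] with x h1 h2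
    rw [h1, Pi.smul_apply, h2]
    have h3 : (fun y => ek κ y * ek (shift 0 k) y) = ek (shift κ k) := by
      funext y
      rw [← ek_add, ← shift_eq_add]
    ext i
    simp only [grad, h3, pderiv_ek, toC3, PiLp.smul_apply, smul_eq_mul]
    ring

lemma smoothPer_conj_ek_smul_grad (κ : R3) {φ : R3 → ℂ} (hφ : SmoothPer φ) :
    SmoothPer fun x => (starRingEnd ℂ) (ek κ x) • grad (fun y => ek κ y * φ y) x := by
  have h : ∀ x i, ((starRingEnd ℂ) (ek κ x) • grad (fun y => ek κ y * φ y) x) i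
      = pderiv i φ x + Complex.I * κ i * φ x := fun x i => by
    simp only [PiLp.smul_apply, grad, smul_eq_mul]
    rw [pderiv_mul i ((contDiff_ek κ).differentiable (by simp) x)
      (hφ.1.differentiable (by simp) x), pderiv_ek]
    linear_combination (pderiv i φ x + Complex.I * κ i * φ x) * conj_ek_mul_self κ x
  refine ⟨contDiff_piLp 2 |>.2 fun i => ?_, fun j x => ?_⟩
  · simp only [h]
    exact (contDiff_pderiv hφ.1 i).add (contDiff_const.mul hφ.1)
  · ext i
    simp only [h, (hφ.pderiv i).2 j x, hφ.2 j x]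

lemma act_sqrtField_act_inv (hpos : ∀ x, (A x).PosDef) (x : R3) (v : C3) :
    act (sqrtField A x) (act (sqrtField A x)⁻¹ v) = v := by
  rw [← act_mul, Matrix.mul_nonsing_inv _ (isUnit_det_sqrtField hpos x), act_one]

lemma act_inv_act_sqrtField (hpos : ∀ x, (A x).PosDef) (x : R3) (v : C3) :
    act (sqrtField A x)⁻¹ (act (sqrtField A x) v) = v := by
  rw [← act_mul, Matrix.nonsing_inv_mul _ (isUnit_det_sqrtField hpos x), act_one]

/-- Multiplied by A^{1/2}, the first component is a gradient, whose curl vanishes; for smooth φ it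
is e_κ times a smooth periodic field, and continuity of `T` passes this to the closure. -/
lemma gradient_mem_Hcurl (hpos : ∀ x, (A x).PosDef) {T : L2Q C3 μ →L[ℂ] L2Q C3 μ}
    (hT : ∀ u, T u =ᵐ[μ.restrict cellQ] fun x => act (sqrtField A x)⁻¹ (u x))
    {p : L2Q ℂ μ × L2Q C3 μ} (hp : p ∈ H1zero μ κ) : (T p.2, 0) ∈ Hcurl μ A κ := by
  have hcont : Continuous fun p : L2Q ℂ μ × L2Q C3 μ => (T p.2, (0 : L2Q C3 μ)) :=
    (T.continuous.comp continuous_snd).prodMk continuous_const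
  refine map_mem_closure
    (f := fun p : L2Q ℂ μ × L2Q C3 μ => (T p.2, (0 : L2Q C3 μ))) hcont hp ?_
  rintro p ⟨φ, hφ, hp1, hp2⟩
  have h1 : ∀ x, ek κ x • (starRingEnd ℂ) (ek κ x) • grad (fun y => ek κ y * φ y) x
      = grad (fun y => ek κ y * φ y) x := fun x => by
    rw [smul_smul, ek_mul_conj_self, one_smul]
  refine ⟨fun x => act (sqrtField A x)⁻¹
    ((starRingEnd ℂ) (ek κ x) • grad (fun y => ek κ y * φ y) x), ?_, ?_, ?_⟩
  · simp only [act_sqrtField_act_inv hpos]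
    exact smoothPer_conj_ek_smul_grad κ hφ.1
  · filter_upwards [hT p.2, hp2] with x h2 h3
    rw [h2, h3, ← act_smul, h1]
  · simp only [act_sqrtField_act_inv hpos, h1]
    filter_upwards [Lp.coeFn_zero C3 2 (μ.restrict cellQ)] with x hx
    rw [hx, Pi.zero_apply]
    exact (curl_grad (contDiff_ek_mul hφ.1 κ) x).symm

lemma planeWave_mem_Hcurl [IsFiniteMeasure (μ.restrict cellQ)] (hpos : ∀ x, (A x).PosDef)
    {T : L2Q C3 μ →L[ℂ] L2Q C3 μ}
    (hT : ∀ u, T u =ᵐ[μ.restrict cellQ] fun x => act (sqrtField A x)⁻¹ (u x)) (v : C3) :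
    (T (planeWave μ κ v), planeWave μ κ (cact (crossI κ) v)) ∈ Hcurl μ A κ := by
  refine subset_closure ⟨fun x => act (sqrtField A x)⁻¹ v, ?_, ?_, ?_⟩
  · simp only [act_sqrtField_act_inv hpos]
    exact ⟨contDiff_const, fun i x => rfl⟩
  · filter_upwards [hT (planeWave μ κ v), coeFn_planeWave (μ := μ) κ v] with x h1 h2
    rw [h1, h2, act_smul]
  · simp only [act_sqrtField_act_inv hpos]
    filter_upwards [coeFn_planeWave (μ := μ) κ (cact (crossI κ) v)] with x h1
    rw [h1, curl_ek_smul_const]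

/-! ### The duality estimate -/

/-- A field `F` which is divergence free and has mean zero pairs with `u` up to the norm of
`curl u`. -/
lemma norm_inner_le_of_divFree [IsProbabilityMeasure (μ.restrict cellQ)]
    (hmean : IsDerivMeanFree μ)
    (hκ : κ ∈ dualQ) {u w F : L2Q C3 μ}
    (hw : ∀ k, coef μ (shift κ k) w = cact (crossI (shift κ k)) (coef μ (shift κ k) u))
    (hF0 : coef μ κ F = 0)
    (hF : ∀ k, k ≠ 0 → inner ℂ (toC3 (shift κ k)) (coef μ (shift κ k) F) = (0 : ℂ))
    {ε : ℝ} (hε : 0 < ε) :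
    ‖(inner ℂ u F : ℂ)‖ ≤ ‖w‖ ^ 2 / ε ^ 2 + (ε / (2 * Real.pi)) ^ 2 * ‖F‖ ^ 2 := by
  have hsq : ∀ z : L2Q C3 μ, HasSum (fun k => ‖coef μ (shift κ k) z‖ ^ 2) (‖z‖ ^ 2) := fun z => by
    have h := Complex.hasSum_re (hasSum_inner_coef hmean κ z z)
    simpa only [inner_self_eq_norm_sq_to_K, ← Complex.ofReal_pow, Complex.coe_algebraMap,
      Complex.ofReal_re] using h
  refine (hasSum_inner_coef hmean κ u F).norm_le_of_bounded
    (((hsq w).div_const (ε ^ 2)).add ((hsq F).mul_left ((ε / (2 * Real.pi)) ^ 2))) fun k => ?_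
  -- The frequency κ itself may be arbitrarily small; there the bound relies on F having no
  -- component.
  by_cases hk : k = 0
  · subst hk
    rw [shift_zero_right, hF0, inner_zero_right, norm_zero]
    positivity
  · refine (norm_inner_le_of_transversal Real.pi_pos (pi_le_norm_shift hκ hk) _ (hF k hk)).trans ?_
    rw [← hw]
    set a := ‖coef μ (shift κ k) w‖
    set b := ‖coef μ (shift κ k) F‖
    -- Young's inequality, weighted so that the curl term carries exactly the ε⁻² of the energy
    -- identity.
    have : a ^ 2 / ε ^ 2 + (ε / (2 * Real.pi)) ^ 2 * b ^ 2 - a * b / Real.pi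
        = (a / ε - ε / (2 * Real.pi) * b) ^ 2 := by
      field_simp
      ring
    nlinarith [sq_nonneg (a / ε - ε / (2 * Real.pi) * b)]

/-! ### The cell problem -/

lemma eq_sum_single (v : C3) : v = ∑ j, v j • EuclideanSpace.single j (1 : ℂ) := by
  ext i
  fin_cases i <;> simp [Fin.sum_univ_three]

lemma cact_eq_sum (M : Matrix (Fin 3) (Fin 3) ℂ) (v : C3) :
    cact M v = ∑ j, v j • cact M (EuclideanSpace.single j (1 : ℂ)) := by
  ext i
  simp [cact, Matrix.mulVec, dotProduct, Fin.sum_univ_three, mul_comm]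

lemma inner_mulOperator {M : R3 → Matrix (Fin 3) (Fin 3) ℝ} (hM : ∀ x, (M x).IsHermitian)
    {T : L2Q C3 μ →L[ℂ] L2Q C3 μ}
    (hT : ∀ u, T u =ᵐ[μ.restrict cellQ] fun x => act (M x) (u x)) (u v : L2Q C3 μ) :
    (inner ℂ (T u) v : ℂ) = inner ℂ u (T v) := by
  rw [L2.inner_def, L2.inner_def]
  refine integral_congr_ae ?_
  filter_upwards [hT u, hT v] with x h1 h2
  rw [h1, h2, inner_act (hM x)]

lemma coeFn_inv_inv (hpos : ∀ x, (A x).PosDef) {T : L2Q C3 μ →L[ℂ] L2Q C3 μ}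
    (hT : ∀ u, T u =ᵐ[μ.restrict cellQ] fun x => act (sqrtField A x)⁻¹ (u x)) (u : L2Q C3 μ) :
    T (T u) =ᵐ[μ.restrict cellQ] fun x => act (A x)⁻¹ (u x) := by
  filter_upwards [hT u, hT (T u)] with x h1 h2
  rw [h2, h1, ← act_mul, inv_sqrtField_mul_self hpos]

lemma exists_cellFields [IsProbabilityMeasure (μ.restrict cellQ)]
    (hpos : ∀ x, (A x).PosDef) {T : L2Q C3 μ →L[ℂ] L2Q C3 μ}
    (hT : ∀ u, T u =ᵐ[μ.restrict cellQ] fun x => act (sqrtField A x)⁻¹ (u x))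
    {Ψ : Fin 3 → R3 → ℂ} {g : Fin 3 → R3 → C3} (hΨ : IsCellSolution μ A κ Ψ g) (j : Fin 3) :
    ∃ r ∈ H1zero μ κ, r.2 =ᵐ[μ.restrict cellQ] g j ∧ ∀ q ∈ H1zero μ κ,
      (inner ℂ q.2 (T (T (r.2 + planeWave μ κ (EuclideanSpace.single j 1)))) : ℂ) = 0 := by
  obtain ⟨⟨r, hr, -, hrg⟩, hweak⟩ := hΨ j
  refine ⟨r, hr, hrg, fun q hq => ?_⟩
  refine closure_minimal (t := {q : L2Q ℂ μ × L2Q C3 μ | (inner ℂ q.2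
    (T (T (r.2 + planeWave μ κ (EuclideanSpace.single j 1)))) : ℂ) = 0}) ?_
    (isClosed_eq (continuous_snd.inner continuous_const) continuous_const) hq
  rintro q ⟨φ, hφ, -, hq2⟩
  change (inner ℂ _ _ : ℂ) = 0
  rw [map_add, map_add, inner_add_right, L2.inner_def, L2.inner_def, add_eq_zero_iff_eq_neg]
  refine Eq.trans ?_ ((hweak φ hφ).trans (congrArg _ ?_))
  · refine integral_congr_ae ?_
    filter_upwards [hq2, coeFn_inv_inv hpos hT r.2, hrg] with x h1 h2 h3
    rw [h1, h2, h3]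
  · refine integral_congr_ae ?_
    filter_upwards [hq2, coeFn_inv_inv hpos hT (planeWave μ κ (EuclideanSpace.single j 1)),
      coeFn_planeWave (μ := μ) κ (EuclideanSpace.single j 1)] with x h1 h2 h3
    rw [h1, h2, h3]

lemma coeFn_sum_smul (v : Fin 3 → ℂ) (P : Fin 3 → L2Q C3 μ) :
    (∑ j, v j • P j : L2Q C3 μ) =ᵐ[μ.restrict cellQ] fun x => ∑ j, v j • P j x := by
  rw [Fin.sum_univ_three]
  filter_upwards [Lp.coeFn_add (v 0 • P 0 + v 1 • P 1) (v 2 • P 2),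
    Lp.coeFn_add (v 0 • P 0) (v 1 • P 1), Lp.coeFn_smul (v 0) (P 0), Lp.coeFn_smul (v 1) (P 1),
    Lp.coeFn_smul (v 2) (P 2)] with x h1 h2 h3 h4 h5
  rw [h1, Pi.add_apply, h2, Pi.add_apply, h3, h4, h5, Fin.sum_univ_three]
  rfl

/-- The properties of the fields `U v = (∇(e_κ Ψ) + e_κ I) v` for a solution `Ψ` of the cell
problem. -/
lemma exists_corrector [IsProbabilityMeasure (μ.restrict cellQ)] (hmean : IsDerivMeanFree μ)
    (hpos : ∀ x, (A x).PosDef) {T : L2Q C3 μ →L[ℂ] L2Q C3 μ}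
    (hT : ∀ u, T u =ᵐ[μ.restrict cellQ] fun x => act (sqrtField A x)⁻¹ (u x))
    {Ψ : Fin 3 → R3 → ℂ} {g : Fin 3 → R3 → C3} (hΨ : IsCellSolution μ A κ Ψ g) :
    ∃ U : C3 → L2Q C3 μ,
      (∀ v, U v =ᵐ[μ.restrict cellQ] fun x => ek κ x • cact (correctorMatrix κ g x) v) ∧
      (∀ v, ∀ q ∈ H1zero μ κ, (inner ℂ q.2 (T (T (U v))) : ℂ) = 0) ∧
      (∀ v w, (inner ℂ (U v) (T (T (U w))) : ℂ) = inner ℂ v (coef μ κ (T (T (U w))))) ∧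
      (∀ v, (T (U v), planeWave μ κ (cact (crossI κ) v)) ∈ Hcurl μ A κ) ∧
      (∀ v, coef μ κ (U v) = v) ∧
      (∀ v, cact (hatAhom μ A κ g) v = coef μ κ (T (T (U v)))) := by
  choose r hr hrg hrT using exists_cellFields hpos hT hΨ
  set P : Fin 3 → L2Q C3 μ := fun j => (r j).2 + planeWave μ κ (EuclideanSpace.single j 1) with hP
  have hPx : ∀ j, P j =ᵐ[μ.restrict cellQ]
      fun x => g j x + ek κ x • EuclideanSpace.single j (1 : ℂ) := fun j => by
    filter_upwards [Lp.coeFn_add (r j).2 (planeWave μ κ (EuclideanSpace.single j 1)), hrg j,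
      coeFn_planeWave (μ := μ) κ (EuclideanSpace.single j 1)] with x h1 h2 h3
    rw [h1, Pi.add_apply, h2, h3]
  have hcorr : ∀ j x i, (starRingEnd ℂ) (ek κ x) * (g j x + ek κ x • EuclideanSpace.single j (1 : ℂ)) i
      = correctorMatrix κ g x i j := fun j x i => by
    have h := conj_ek_mul_self κ x
    simp only [correctorMatrix, Matrix.add_apply, Matrix.of_apply, Matrix.one_apply, PiLp.add_apply,
      PiLp.smul_apply, smul_eq_mul, mul_add, ← mul_assoc, h, one_mul]
    simp [PiLp.single_apply]
  have horth : ∀ v : C3, ∀ q ∈ H1zero μ κ, (inner ℂ q.2 (T (T (∑ j, v j • P j))) : ℂ) = 0 := by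
    intro v q hq
    simp only [map_sum, map_smul, inner_sum, inner_smul_right]
    exact Finset.sum_eq_zero fun j _ => by rw [hrT j q hq, mul_zero]
  refine ⟨fun v => ∑ j, v j • P j, fun v => ?_, horth, fun v w => ?_, fun v => ?_, fun v => ?_,
    fun v => ?_⟩
  · filter_upwards [coeFn_sum_smul v P, hPx 0, hPx 1, hPx 2] with x h h0 h1 h2
    rw [h]
    ext i
    have e := ek_mul_conj_self κ x
    simp only [Fin.sum_univ_three, h0, h1, h2, PiLp.add_apply (p := 2), PiLp.smul_apply (p := 2),
      smul_eq_mul, cact, Matrix.mulVec, dotProduct, ← hcorr]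
    linear_combination (-(v 0 * (g 0 x i + ek κ x * EuclideanSpace.single 0 (1 : ℂ) i)
      + v 1 * (g 1 x i + ek κ x * EuclideanSpace.single 1 (1 : ℂ) i)
      + v 2 * (g 2 x i + ek κ x * EuclideanSpace.single 2 (1 : ℂ) i))) * e
  -- U v differs from the plane wave e_κ v by gradients, to which A⁻¹ U w is orthogonal.
  · rw [inner_coef]
    conv_rhs => rw [eq_sum_single v]
    simp only [map_sum (planeWave μ κ), map_smul (planeWave μ κ), sum_inner, inner_smul_left]
    refine Finset.sum_congr rfl fun j _ => ?_
    rw [show P j = (r j).2 + planeWave μ κ (EuclideanSpace.single j 1) from rfl, inner_add_left,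
      horth w _ (hr j), zero_add]
  · rw [cact_eq_sum]
    have : (T (∑ j, v j • P j), planeWave μ κ (∑ j, v j • cact (crossI κ) (EuclideanSpace.single j 1)))
        = ∑ j, v j • (((T (r j).2, 0) : L2Q C3 μ × L2Q C3 μ)
          + (T (planeWave μ κ (EuclideanSpace.single j 1)),
            planeWave μ κ (cact (crossI κ) (EuclideanSpace.single j 1)))) := by
      simp [hP, Fin.sum_univ_three]
    rw [this, Hcurl_eq]
    refine Submodule.sum_mem _ fun j _ => Submodule.smul_mem _ _ (Submodule.add_mem _ ?_ ?_)
    · exact gradient_mem_Hcurl hpos hT (hr j)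
    · exact planeWave_mem_Hcurl hpos hT _
  · conv_rhs => rw [eq_sum_single v]
    simp only [map_sum, map_smul]
    refine Finset.sum_congr rfl fun j _ => ?_
    have h := coef_planeWave hmean κ 0 0 (EuclideanSpace.single j (1 : ℂ))
    rw [shift_zero_right, if_pos rfl] at h
    rw [show P j = (r j).2 + planeWave μ κ (EuclideanSpace.single j 1) from rfl, map_add,
      coef_snd_of_mem_H1zero hmean (hr j), zero_add, h]
  · rw [cact_eq_sum]
    simp only [map_sum, map_smul]
    refine Finset.sum_congr rfl fun j _ => ?_
    congr 1
    ext i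
    rw [coef_apply]
    have : cact (hatAhom μ A κ g) (EuclideanSpace.single j 1) i = hatAhom μ A κ g i j := by
      simp [cact]
    rw [this, hatAhom, Matrix.of_apply]
    refine integral_congr_ae ?_
    filter_upwards [coeFn_inv_inv hpos hT (P j), hPx j] with x h1 h2
    rw [h1, h2]
    simp only [Matrix.mul_apply, ← hcorr, act, Matrix.mulVec, dotProduct, Finset.mul_sum]
    exact Finset.sum_congr rfl fun l _ => by ring

/-! ### The estimate -/

lemma continuous_of_differentiable_entries
    (hA : ∀ i j : Fin 3, Differentiable ℝ (fun x => A x i j)) : Continuous A :=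
  continuous_matrix fun i j => (hA i j).continuous

lemma norm_planeWave [IsProbabilityMeasure (μ.restrict cellQ)] (hmean : IsDerivMeanFree μ)
    (κ : R3) (v : C3) : ‖planeWave μ κ v‖ = ‖v‖ := by
  have h := coef_planeWave hmean κ 0 0 v
  rw [shift_zero_right, if_pos rfl] at h
  have h2 : (inner ℂ (planeWave μ κ v) (planeWave μ κ v) : ℂ) = inner ℂ v v := by
    rw [← inner_coef, h]
  rw [inner_self_eq_norm_sq_to_K, inner_self_eq_norm_sq_to_K] at h2
  have h3 : ‖planeWave μ κ v‖ ^ 2 = ‖v‖ ^ 2 := by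
    apply Complex.ofReal_injective
    simpa using h2
  exact (sq_eq_sq₀ (norm_nonneg _) (norm_nonneg _)).1 h3

lemma norm_coef_le [IsProbabilityMeasure (μ.restrict cellQ)] (hmean : IsDerivMeanFree μ)
    (κ : R3) (u : L2Q C3 μ) : ‖coef μ κ u‖ ≤ ‖u‖ := by
  have h : ‖coef μ κ‖ ≤ 1 := by
    rw [coef, LinearIsometryEquiv.norm_map]
    exact ContinuousLinearMap.opNorm_le_bound _ zero_le_one fun v => by
      rw [norm_planeWave hmean, one_mul]
  simpa using (coef μ κ).le_of_opNorm_le h u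

lemma inner_coef_left [IsFiniteMeasure (μ.restrict cellQ)] (ξ : R3) (v : C3) (u : L2Q C3 μ) :
    inner ℂ (coef μ ξ u) v = inner ℂ u (planeWave μ ξ v) :=
  ContinuousLinearMap.adjoint_inner_left _ _ _

lemma memLp_ek_smul {G : R3 → C3} (hG : MemLp G 2 (μ.restrict cellQ)) (κ : R3) :
    MemLp (fun x => ek κ x • G x) 2 (μ.restrict cellQ) :=
  hG.of_le ((continuous_ek κ).aestronglyMeasurable.smul hG.1)
    (Filter.Eventually.of_forall fun x => by simp [norm_smul, norm_ek])

/-- Test the divergence condition with the periodic exponential of index k. -/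
lemma coef_toLp_of_isDivFree [IsFiniteMeasure (μ.restrict cellQ)] {G : R3 → C3}
    (hG : IsDivFree μ κ G) (k : Fin 3 → ℤ) :
    inner ℂ (toC3 (shift κ k)) (coef μ (shift κ k) (memLp_ek_smul hG.1 κ).toLp) = (0 : ℂ) := by
  have h := hG.2 _ (smoothPer_ek_shift_zero k)
  have h3 : (fun y => ek κ y * ek (shift 0 k) y) = ek (shift κ k) := by
    funext y
    rw [← ek_add, ← shift_eq_add]
  have h4 : ∀ x, grad (ek (shift κ k)) x = Complex.I • ek (shift κ k) x • toC3 (shift κ k) := by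
    intro x
    ext i
    simp only [grad, pderiv_ek, toC3, PiLp.smul_apply, smul_eq_mul]
    ring
  simp only [h3, h4, inner_smul_left (𝕜 := ℂ) _ _ Complex.I] at h
  rw [integral_const_mul, mul_eq_zero] at h
  rw [inner_coef, inner_planeWave]
  refine Eq.trans (integral_congr_ae ?_) (h.resolve_left (by simp))
  filter_upwards [(memLp_ek_smul hG.1 κ).coeFn_toLp] with x hx
  rw [hx, inner_smul_left]

lemma coef_toLp [IsFiniteMeasure (μ.restrict cellQ)] {G : R3 → C3}
    (hG : MemLp G 2 (μ.restrict cellQ)) :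
    coef μ κ (memLp_ek_smul hG κ).toLp = ∫ x in cellQ, G x ∂μ := by
  have hi : Integrable G (μ.restrict cellQ) := hG.integrable (by norm_num)
  ext i
  rw [coef_apply]
  have h := (EuclideanSpace.proj (𝕜 := ℂ) i : C3 →L[ℂ] ℂ).integral_comp_comm hi
  refine Eq.trans ?_ h
  refine integral_congr_ae ?_
  filter_upwards [(memLp_ek_smul hG κ).coeFn_toLp] with x hx
  rw [hx, PiLp.smul_apply, smul_eq_mul, ← mul_assoc, conj_ek_mul_self, one_mul]
  rfl

/-- The test field is conj(e_κ) times the first component of the pair, so every integral becomes an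
L² inner product of twisted fields. -/
lemma maxwell_weak {S : L2Q C3 μ →L[ℂ] L2Q C3 μ}
    (hS : ∀ u, S u =ᵐ[μ.restrict cellQ] fun x => act (sqrtField A x) (u x))
    {ε : ℝ} {G D : R3 → C3} (hG : MemLp G 2 (μ.restrict cellQ))
    (hD : IsMaxwellSolution μ A ε κ G D) :
    ∃ p ∈ Hcurl μ A κ, p.1 =ᵐ[μ.restrict cellQ] (fun x => ek κ x • D x) ∧
      ∀ q ∈ Hcurl μ A κ, ((ε ^ 2)⁻¹ : ℂ) * inner ℂ q.2 p.2 + inner ℂ q.1 p.1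
        = -inner ℂ (S q.1) (memLp_ek_smul hG κ).toLp := by
  obtain ⟨p, hp, hpD, hweak⟩ := hD
  refine ⟨p, hp, hpD, fun q hq => ?_⟩
  have hcancel : ∀ x, ∀ u : C3, ek κ x • (starRingEnd ℂ) (ek κ x) • u = u := fun x u => by
    rw [smul_smul, ek_mul_conj_self, one_smul]
  have h := hweak q hq (fun x => (starRingEnd ℂ) (ek κ x) • q.1 x)
    (Filter.Eventually.of_forall fun x => (hcancel x _).symm)
  have hin : ∀ x, ∀ u v : C3, (inner ℂ ((starRingEnd ℂ) (ek κ x) • u) v : ℂ)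
      = inner ℂ u (ek κ x • v) := fun x u v => by
    rw [inner_smul_left, inner_smul_right, Complex.conj_conj]
  rw [inner_mulOperator (sqrtField_isHermitian A) hS, L2.inner_def, L2.inner_def, L2.inner_def]
  refine Eq.trans ?_ (h.trans (congrArg _ ?_))
  · congr 1
    refine integral_congr_ae ?_
    filter_upwards [hpD] with x hx
    rw [hx, hin]
  · refine integral_congr_ae ?_
    filter_upwards [hS (memLp_ek_smul hG κ).toLp, (memLp_ek_smul hG κ).coeFn_toLp] with x h1 h2
    rw [h1, h2, hin, act_smul]

/-- The matrices `Â^hom` and `(iθ×)² (Â^hom)⁻¹ + I` are invertible and `d` solves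
the homogenised equation. -/
lemma symbol_solution {α : ℝ} (hα : 0 < α) {H : Matrix (Fin 3) (Fin 3) ℂ}
    (hH : ∀ v : C3, α * ‖v‖ ^ 2 ≤ (inner ℂ v (cact H v) : ℂ).re) (θ : R3) (μ : Measure R3)
    (G : R3 → C3) :
    IsUnit H ∧ IsUnit (symbolMatrix θ H) ∧
      cact (crossI θ) (cact (crossI θ) (WithLp.toLp 2 (dVec μ θ H G)))
        + cact H (WithLp.toLp 2 (dVec μ θ H G)) = -∫ x in cellQ, G x ∂μ := by
  have hHu := isUnit_of_coercive hα hH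
  have hKpos : ∀ v : C3, 0 ≤ (inner ℂ v (cact (crossI θ) (cact (crossI θ) v)) : ℂ).re := fun v => by
    rw [← inner_cact_crossI]
    exact inner_self_nonneg (𝕜 := ℂ) (x := cact (crossI θ) v)
  have hZ : IsUnit (crossI θ * crossI θ + H) := isUnit_of_coercive hα fun v => by
    rw [cact_add, cact_mul, inner_add_right, Complex.add_re]
    linarith [hH v, hKpos v]
  have hdet := (Matrix.isUnit_iff_isUnit_det _).1 hHu
  have hdetZ := (Matrix.isUnit_iff_isUnit_det _).1 hZ
  -- With K = iθ×, the symbol factors as (K² + H) H⁻¹, so d = -(K² + H)⁻¹ ∫ G. Invertibility follows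
  -- because K² is nonnegative and H coercive.
  have hsym : symbolMatrix θ H = (crossI θ * crossI θ + H) * H⁻¹ := by
    rw [symbolMatrix, add_mul, Matrix.mul_nonsing_inv _ hdet]
  have hHinv : IsUnit H⁻¹ := (Matrix.isUnit_nonsing_inv_iff).2 hHu
  refine ⟨hHu, hsym ▸ hZ.mul hHinv, ?_⟩
  rw [← cact_mul, ← cact_add, dVec, hsym, Matrix.mul_inv_rev, Matrix.nonsing_inv_nonsing_inv _ hdet,
    ← mul_assoc, Matrix.nonsing_inv_mul _ hdet, one_mul]
  simp [cact, Matrix.mulVec_neg, Matrix.mulVec_mulVec, Matrix.mul_nonsing_inv _ hdetZ]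

/-- The energy estimate for the error. `W` carries the unimodular factor e_κ, and the constant
involves only `m` and ‖T‖, so it is uniform in ε, θ and G. -/
lemma norm_error_le [IsProbabilityMeasure (μ.restrict cellQ)] (hmean : IsDerivMeanFree μ)
    (hpos : ∀ x, (A x).PosDef) {S T : L2Q C3 μ →L[ℂ] L2Q C3 μ}
    (hS : ∀ u, S u =ᵐ[μ.restrict cellQ] fun x => act (sqrtField A x) (u x))
    (hT : ∀ u, T u =ᵐ[μ.restrict cellQ] fun x => act (sqrtField A x)⁻¹ (u x))
    {m : ℝ} (hm : 0 < m) (hSm : ‖S‖ ≤ m) {ε : ℝ} {θ : R3} (hε : 0 < ε) (hκ : ε • θ ∈ dualQ)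
    {G D : R3 → C3} {Ψ : Fin 3 → R3 → ℂ} {g : Fin 3 → R3 → C3}
    (hG : IsDivFree μ (ε • θ) G) (hD : IsMaxwellSolution μ A ε (ε • θ) G D)
    (hΨ : IsCellSolution μ A (ε • θ) Ψ g) :
    IsUnit (hatAhom μ A (ε • θ) g) ∧ IsUnit (symbolMatrix θ (hatAhom μ A (ε • θ) g)) ∧
      ∃ W : L2Q C3 μ, (W =ᵐ[μ.restrict cellQ] fun x => ek (ε • θ) x •
          (act (sqrtField A x) (D x) - cact (correctorMatrix (ε • θ) g x)
            (WithLp.toLp 2 (dVec μ θ (hatAhom μ A (ε • θ) g) G)))) ∧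
        ‖W‖ ≤ m / (2 * Real.pi) * (2 * (1 + ‖T‖ ^ 2 * m ^ 2)) * ε
          * ‖(memLp_ek_smul hG.1 (ε • θ)).toLp‖ := by
  obtain ⟨U, hU, hUorth, hUsymm, hUcurl, hUcoef, hUhom⟩ := exists_corrector hmean hpos hT hΨ
  obtain ⟨p, hp, hpD, hweak⟩ := maxwell_weak hS hG.1 hD
  set κ := ε • θ with hκdef
  set H := hatAhom μ A κ g
  set Gt := (memLp_ek_smul hG.1 κ).toLp with hGt
  have hST : ∀ u, S (T u) = u := fun u => Lp.ext (by
    filter_upwards [hS (T u), hT u] with x h1 h2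
    rw [h1, h2, act_sqrtField_act_inv hpos])
  have hTS : ∀ u, T (S u) = u := fun u => Lp.ext (by
    filter_upwards [hT (S u), hS u] with x h1 h2
    rw [h1, h2, act_inv_act_sqrtField hpos])
  have hTsymm : ∀ u v, (inner ℂ (T u) v : ℂ) = inner ℂ u (T v) :=
    inner_mulOperator (fun x => (sqrtField_isHermitian A x).inv) hT
  have hSle : ∀ u, ‖S u‖ ≤ m * ‖u‖ := S.le_of_opNorm_le hSm
  have hdU : ∀ v, ‖v‖ ≤ ‖U v‖ := fun v => by
    conv_lhs => rw [← hUcoef v]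
    exact norm_coef_le hmean κ _
  -- coercivity of the homogenised matrix
  have hHre : ∀ v, ‖U v‖ ^ 2 ≤ m ^ 2 * (inner ℂ v (cact H v) : ℂ).re := fun v => by
    have h1 : (inner ℂ v (cact H v) : ℂ).re = ‖T (U v)‖ ^ 2 := by
      rw [hUhom, ← hUsymm, ← hTsymm]
      exact inner_self_eq_norm_sq (𝕜 := ℂ) (T (U v))
    have h2 := hSle (T (U v))
    rw [hST] at h2
    rw [h1, ← mul_pow]
    exact pow_le_pow_left₀ (norm_nonneg _) h2 2
  have hHco : ∀ v, (m ^ 2)⁻¹ * ‖v‖ ^ 2 ≤ (inner ℂ v (cact H v) : ℂ).re := fun v => by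
    rw [inv_mul_le_iff₀ (by positivity)]
    exact (pow_le_pow_left₀ (norm_nonneg _) (hdU v) 2).trans (hHre v)
  obtain ⟨hu1, hu2, hd⟩ := symbol_solution (by positivity) hHco θ μ G
  refine ⟨hu1, hu2, ?_⟩
  set d : C3 := WithLp.toLp 2 (dVec μ θ H G)
  rw [← coef_toLp (κ := κ) hG.1, ← hGt] at hd
  set b := coef μ κ Gt
  have hb : ‖b‖ ≤ ‖Gt‖ := norm_coef_le hmean κ _
  -- Pair the homogenised equation with d and drop the nonnegative term |iθ×d|²; this bounds ‖U d‖²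
  -- by m² ‖U d‖ ‖Gt‖.
  have hUd : ‖U d‖ ≤ m ^ 2 * ‖Gt‖ := by
    have h1 : (inner ℂ d (cact H d) : ℂ).re ≤ ‖U d‖ * ‖Gt‖ := by
      have h2 : (0 : ℝ) ≤ (inner ℂ d (cact (crossI θ) (cact (crossI θ) d)) : ℂ).re := by
        rw [← inner_cact_crossI]
        exact inner_self_nonneg (𝕜 := ℂ) (x := cact (crossI θ) d)
      have h3 : (inner ℂ d (cact (crossI θ) (cact (crossI θ) d)) : ℂ).re
          + (inner ℂ d (cact H d) : ℂ).re ≤ ‖d‖ * ‖b‖ := by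
        rw [← Complex.add_re, ← inner_add_right, hd, ← norm_neg b]
        exact re_inner_le_norm (𝕜 := ℂ) d (-b)
      have h4 : ‖d‖ * ‖b‖ ≤ ‖U d‖ * ‖Gt‖ := by gcongr; exact hdU d
      linarith
    have h5 := hHre d
    rcases (norm_nonneg (U d)).eq_or_lt with h0 | h0
    · rw [← h0]; positivity
    · refine le_of_mul_le_mul_left ?_ h0
      nlinarith [pow_pos hm 2]
  set a := T (T (U d))
  have ha : ‖a‖ ≤ ‖T‖ ^ 2 * m ^ 2 * ‖Gt‖ := by
    calc ‖a‖ ≤ ‖T‖ * (‖T‖ * ‖U d‖) := (T.le_opNorm _).trans (by gcongr; exact T.le_opNorm _)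
      _ ≤ ‖T‖ * (‖T‖ * (m ^ 2 * ‖Gt‖)) := by gcongr
      _ = _ := by ring
  -- the residual
  set F := planeWave μ κ (b + cact H d) - (Gt + a) with hF
  -- The amplitude b + H d is the coefficient of Gt + a at κ, so the plane wave is no larger than Gt
  -- + a.
  have hFnorm : ‖F‖ ≤ 2 * (1 + ‖T‖ ^ 2 * m ^ 2) * ‖Gt‖ := by
    have h1 : ‖planeWave μ κ (b + cact H d)‖ ≤ ‖Gt + a‖ := by
      rw [norm_planeWave hmean, hUhom, ← map_add]
      exact norm_coef_le hmean κ _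
    have h2 := norm_sub_le (planeWave μ κ (b + cact H d)) (Gt + a)
    have h3 := norm_add_le Gt a
    rw [← hF] at h2
    linarith
  have hF0 : coef μ κ F = 0 := by
    have h := coef_planeWave hmean κ 0 0 (b + cact H d)
    rw [shift_zero_right, if_pos rfl] at h
    rw [hF, map_sub, h, map_add, hUhom, sub_self]
  have hFk : ∀ k, k ≠ 0 → inner ℂ (toC3 (shift κ k)) (coef μ (shift κ k) F) = (0 : ℂ) := by
    intro k hk
    have h := coef_planeWave hmean κ k 0 (b + cact H d)
    rw [shift_zero_right, if_neg hk] at h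
    obtain ⟨r, hr, hr2⟩ := exists_mem_H1zero_planeWave (κ := κ) hmean hk
    have h2 := hUorth d r hr
    rw [hr2, inner_smul_left, mul_eq_zero] at h2
    rw [hF, map_sub, h, zero_sub, map_add, inner_neg_right, inner_add_right,
      coef_toLp_of_isDivFree hG, inner_coef, h2.resolve_left (by simp), add_zero, neg_zero]
  -- the error as a test function
  set w := p - (T (U d), planeWave μ κ (cact (crossI κ) d)) with hw
  have hwm : w ∈ Hcurl μ A κ := by
    rw [Hcurl_eq] at hp ⊢
    exact Submodule.sub_mem _ hp (hUcurl d)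
  have hcurl := fun k => coef_snd_of_mem_Hcurl hmean hS hwm k
  have hp1 : p.1 = w.1 + T (U d) := by rw [hw, Prod.fst_sub, sub_add_cancel]
  have hp2 : p.2 = w.2 + planeWave μ κ (cact (crossI κ) d) := by
    rw [hw, Prod.snd_sub, sub_add_cancel]
  have henergy : ((ε ^ 2)⁻¹ : ℂ) * inner ℂ w.2 w.2 + inner ℂ w.1 w.1 = inner ℂ (S w.1) F := by
    have h := hweak w hwm
    have h1 : (inner ℂ w.1 (T (U d)) : ℂ) = inner ℂ (S w.1) a := by
      conv_lhs => rw [← hTS w.1, hTsymm]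
    -- Only frequency κ of the curl of S w.1 is seen; two factors κ = εθ produce the ε² that cancels
    -- ε⁻².
    have h2 : (inner ℂ w.2 (planeWave μ κ (cact (crossI κ) d)) : ℂ)
        = (ε : ℂ) ^ 2 * inner ℂ (S w.1)
          (planeWave μ κ (cact (crossI θ) (cact (crossI θ) d))) := by
      have h3 := hcurl 0
      rw [shift_zero_right] at h3
      rw [← inner_coef_left, h3, inner_cact_crossI, ← cact_mul, hκdef, crossI_smul,
        Matrix.smul_mul, Matrix.mul_smul, cact_smul, cact_smul, inner_smul_right, inner_smul_right,
        cact_mul, ← hκdef, inner_coef_left]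
      ring
    have h4 : b + cact H d = -cact (crossI θ) (cact (crossI θ) d) := by
      rw [eq_neg_iff_add_eq_zero, add_assoc, add_comm (cact H d), hd, add_neg_cancel]
    rw [hp1, hp2, inner_add_right, inner_add_right, h1, h2] at h
    rw [hF, h4, map_neg, inner_sub_right, inner_add_right, inner_neg_right]
    have hε' : (ε : ℂ) ^ 2 ≠ 0 := pow_ne_zero _ (by exact_mod_cast hε.ne')
    linear_combination h - inner ℂ (S w.1) (planeWave μ κ (cact (crossI θ) (cact (crossI θ) d)))
      * inv_mul_cancel₀ hε'
  have hreal : (ε ^ 2)⁻¹ * ‖w.2‖ ^ 2 + ‖w.1‖ ^ 2 ≤ ‖(inner ℂ (S w.1) F : ℂ)‖ := by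
    refine le_trans (le_of_eq ?_) (Complex.re_le_norm _)
    rw [← henergy, inner_self_eq_norm_sq_to_K, inner_self_eq_norm_sq_to_K]
    simp only [Complex.coe_algebraMap, ← Complex.ofReal_pow, ← Complex.ofReal_inv,
      ← Complex.ofReal_mul, ← Complex.ofReal_add, Complex.ofReal_re]
  have hdual := norm_inner_le_of_divFree hmean hκ hcurl hF0 hFk hε
  -- The curl terms in `hreal` and `hdual` are identical and cancel.
  have hw1 : ‖w.1‖ ≤ ε / (2 * Real.pi) * ‖F‖ := by
    refine (sq_le_sq₀ (norm_nonneg _) (by positivity)).1 ?_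
    rw [mul_pow]
    have : (ε ^ 2)⁻¹ * ‖w.2‖ ^ 2 = ‖w.2‖ ^ 2 / ε ^ 2 := by rw [div_eq_inv_mul]
    linarith
  refine ⟨S w.1, ?_, ?_⟩
  · have h1 : S w.1 = S p.1 - U d := by rw [hp1, map_add, hST, add_sub_cancel_right]
    rw [h1]
    filter_upwards [Lp.coeFn_sub (S p.1) (U d), hS p.1, hpD, hU d] with x h1 h2 h3 h4
    rw [h1, Pi.sub_apply, h2, h3, h4, act_smul, smul_sub]
  · calc ‖S w.1‖ ≤ m * ‖w.1‖ := hSle _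
      _ ≤ m * (ε / (2 * Real.pi) * (2 * (1 + ‖T‖ ^ 2 * m ^ 2) * ‖Gt‖)) := by
        gcongr
        exact hw1.trans (by gcongr)
      _ = _ := by ring

end Maxwell

end

theorem mainTheorem10
    (μ : MeasureTheory.Measure Maxwell.R3)
    (hper : ∀ i : Fin 3, μ.map (fun x => x + Maxwell.stdVec i) = μ)
    (hmass : μ Maxwell.cellQ = 1)
    (hmean : ∀ φ : Maxwell.R3 → ℂ, Maxwell.SmoothPer φ →
      ∀ j : Fin 3, ∫ x in Maxwell.cellQ, Maxwell.pderiv j φ x ∂μ = 0)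
    (A : Maxwell.R3 → Matrix (Fin 3) (Fin 3) ℝ)
    (hAdiff : ∀ i j : Fin 3, Differentiable ℝ (fun x => A x i j))
    (hAper : Maxwell.IsQPeriodic A)
    (hApos : ∀ x, (A x).PosDef) :
    ∃ C : ℝ, 0 < C ∧
      ∀ (ε : ℝ) (θ : Maxwell.R3), 0 < ε → ε • θ ∈ Maxwell.dualQ →
      ∀ (G D : Maxwell.R3 → Maxwell.C3)
        (Ψ : Fin 3 → Maxwell.R3 → ℂ) (g : Fin 3 → Maxwell.R3 → Maxwell.C3),
        Maxwell.IsDivFree μ (ε • θ) G →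
        Maxwell.IsMaxwellSolution μ A ε (ε • θ) G D →
        Maxwell.IsCellSolution μ A (ε • θ) Ψ g →
        IsUnit (Maxwell.hatAhom μ A (ε • θ) g) ∧
        IsUnit (Maxwell.symbolMatrix θ (Maxwell.hatAhom μ A (ε • θ) g)) ∧
        MeasureTheory.eLpNorm
            (fun x => Maxwell.act (Maxwell.sqrtField A x) (D x)
              - WithLp.toLp 2 ((Maxwell.correctorMatrix (ε • θ) g x).mulVec
                  (Maxwell.dVec μ θ (Maxwell.hatAhom μ A (ε • θ) g) G)))
            2 (μ.restrict Maxwell.cellQ)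
          ≤ ENNReal.ofReal (C * ε) * MeasureTheory.eLpNorm G 2 (μ.restrict Maxwell.cellQ) := by
  have : MeasureTheory.IsProbabilityMeasure (μ.restrict Maxwell.cellQ) :=
    ⟨by rw [MeasureTheory.Measure.restrict_apply_univ, hmass]⟩
  have hA := Maxwell.continuous_of_differentiable_entries hAdiff
  obtain ⟨S, hS⟩ := Maxwell.exists_mulOperator (μ := μ) (Maxwell.continuous_sqrtField hA hApos)
  obtain ⟨T, hT⟩ := Maxwell.exists_mulOperator (μ := μ) (Maxwell.continuous_inv_sqrtField hA hApos)
  -- Adding 1 gives a strictly positive bound for ‖S‖ without showing S ≠ 0.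
  have hm : 0 < ‖S‖ + 1 := by positivity
  have hC : 0 < (‖S‖ + 1) / (2 * Real.pi) * (2 * (1 + ‖T‖ ^ 2 * (‖S‖ + 1) ^ 2)) := by positivity
  refine ⟨_, hC, fun ε θ hε hκ G D Ψ g hG hD hΨ => ?_⟩
  obtain ⟨h1, h2, W, hW, hle⟩ := Maxwell.norm_error_le hmean hApos hS hT hm
    (le_add_of_nonneg_right zero_le_one) hε hκ hG hD hΨ
  refine ⟨h1, h2, ?_⟩
  have hnorm : ∀ x, ∀ v : Maxwell.C3, ‖Maxwell.ek (ε • θ) x • v‖ = ‖v‖ := fun x v => by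
    rw [norm_smul, Maxwell.norm_ek, one_mul]
  have hWn : MeasureTheory.eLpNorm (fun x => Maxwell.act (Maxwell.sqrtField A x) (D x)
      - WithLp.toLp 2 ((Maxwell.correctorMatrix (ε • θ) g x).mulVec
        (Maxwell.dVec μ θ (Maxwell.hatAhom μ A (ε • θ) g) G))) 2 (μ.restrict Maxwell.cellQ)
      = ENNReal.ofReal ‖W‖ := by
    rw [ofReal_norm, MeasureTheory.Lp.enorm_def]
    refine MeasureTheory.eLpNorm_congr_norm_ae ?_
    filter_upwards [hW] with x hx
    rw [hx, hnorm]
    rfl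
  have hGn : MeasureTheory.eLpNorm G 2 (μ.restrict Maxwell.cellQ)
      = ENNReal.ofReal ‖(Maxwell.memLp_ek_smul hG.1 (ε • θ)).toLp‖ := by
    rw [ofReal_norm, MeasureTheory.Lp.enorm_def]
    refine MeasureTheory.eLpNorm_congr_norm_ae ?_
    filter_upwards [(Maxwell.memLp_ek_smul hG.1 (ε • θ)).coeFn_toLp] with x hx
    rw [hx, hnorm]
  rw [hWn, hGn, ← ENNReal.ofReal_mul (by positivity)]
  exact ENNReal.ofReal_le_ofReal hle
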